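/- **Setting.** A weighted graph $G=(V,E,J)$ is a countable graph $(V,E)$ (multiple edges and loops allowed) with positive weights $(J_e)_{e\in E}$ such that $\sum_{e\in E^\rightarrow_v}J_e<\infty$ for every $v\in V$, where $E^\rightarrow_v$ is the set of edges emanating from $v$. $\operatorname{Aut}(G)$ is the group of graph automorphisms preserving $J$, with the topology of pointwise convergence. A subgroup $\Gamma\subseteq\operatorname{Aut}(G)$ is transitive if for all $x,y\in V$ some $\gamma\in\Gamma$ has $\gamma x=y$; a transitive $\Gamma$ is unimodular if $|\mathrm{Stab}_x y|=|\mathrm{Stab}_y x|$ for all $x,y\in V$, where $\mathrm{Stab}_x y$ is the orbit of $y$ under $\{\gamma\in\Gamma:\gamma x=x\}$. Given a probability measure $\mu$ on $[0,1]^E$, let $\mathbf p=(\mathbf p_e)_{e\in E}$ have law $\mu$, let $(U_e)_{e\in E}$ be i.i.d. uniform on $[0,1]$ and independent of $\mathbf p$, and let $\omega(e)=\mathbf 1(U_e\le\mathbf p_e)$. Write $\mathbf P_\mu,\mathbf E_\mu$ for probability and expectation under the joint law of $(\mathbf p,\omega)$, and $K_v$ for the cluster of $v$, i.e. the set of vertices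 connected to $v$ by edges with $\omega=1$. For $e\in E$ and $n\ge1$ let $\mathscr S'_{e,n}$ be the event that the endpoints of $e$ belong to distinct clusters, each containing at least $n$ vertices and at least one of which is finite. **Theorem (improved two-ghost inequality).** Let $G=(V,E,J)$ be a connected transitive weighted graph, let $o\in V$, and let $\Gamma\subseteq\operatorname{Aut}(G)$ be a closed, transitive, unimodular subgroup. Let $\mu$ be a $\Gamma$-invariant probability measure on $[0,1]^E$ and suppose that there are constants $A<\infty$ and $0\le\theta<1/2$ such that $\mathbf P_\mu(|K_o|\ge n)\le A n^{-\theta}$ for every integer $n\ge1$. Then $$\sum_{e\in E^\rightarrow_o}\mathbf E_\mu\left[\mathbf 1(\mathscr S'_{e,n})\sqrt{\frac{\mathbf p_e}{1-\mathbf p_e}}\right]^2\le\frac{10000\,A^2}{(1-2\theta)^2\,n^{1+2\theta}}\qquad\text{for every integer } n\ge1.$$ (If $\mathbf p_e=1$ then $e$ is almost surely open and the integrand is read as $0$ off $\mathscr S'_{e,n}$.) -/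

import Mathlib

open MeasureTheory
open scoped ENNReal unitInterval Topology

/-- A weighted graph with vertex set `V` and edge set `E`. Multiple edges and loops are allowed:
`ends e` is the unordered pair of endpoints of the edge `e`. Every edge carries a positive weight,
and the total weight of the edges at each vertex is finite. -/
structure WeightedGraph (V E : Type*) where
  ends : E → Sym2 V
  J : E → ℝ
  J_pos : ∀ e, 0 < J e
  summable_J : ∀ v : V, Summable fun e : {e : E // v ∈ ends e} => J e

namespace WeightedGraph

variable {V E : Type*} (G : WeightedGraph V E)

/-- The set of edges emanating from `v`. -/
def edgesAt (v : V) : Set E := {e | v ∈ G.ends e}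

/-- The simple graph on `V` recording which distinct vertices are joined by an edge of `ω`. It has
the same connected components as the spanning subgraph with edge set `ω`. -/
def subgraph (ω : Set E) : SimpleGraph V := SimpleGraph.fromEdgeSet (G.ends '' ω)

def IsConnected : Prop := (G.subgraph Set.univ).Connected

/-- The automorphism group of a weighted graph: pairs of a permutation of the vertices and a
permutation of the edges that respect endpoints and weights. -/
def Aut : Subgroup (Equiv.Perm V × Equiv.Perm E) where
  carrier := {γ | ∀ e, G.ends (γ.2 e) = (G.ends e).map γ.1 ∧ G.J (γ.2 e) = G.J e}
  one_mem' := fun e => by simp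
  mul_mem' := by
    intro a b ha hb e
    refine ⟨?_, ?_⟩
    · simp [(ha (b.2 e)).1, (hb e).1, Sym2.map_map]
    · simp [(ha (b.2 e)).2, (hb e).2]
  inv_mem' := by
    intro a ha e
    obtain ⟨h1, h2⟩ := ha (a.2.symm e)
    rw [Equiv.apply_symm_apply] at h1 h2
    refine ⟨?_, h2.symm⟩
    change G.ends (a.2.symm e) = (G.ends e).map a.1.symm
    rw [h1, Sym2.map_map]
    simp

variable {G}

/-- The action of an automorphism on vertices. -/
def Aut.vert (γ : G.Aut) : Equiv.Perm V := γ.1.1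

/-- The action of an automorphism on edges. -/
def Aut.edge (γ : G.Aut) : Equiv.Perm E := γ.1.2

variable (G)

/-- The topology of pointwise convergence on the automorphism group, where vertices and edges carry
the discrete topology. -/
@[reducible] def autTopology : TopologicalSpace G.Aut :=
  letI : TopologicalSpace V := ⊥
  letI : TopologicalSpace E := ⊥
  TopologicalSpace.induced
    (fun γ => ((Aut.vert γ : V → V), (Aut.edge γ : E → E))) inferInstance

variable {G}

/-- A group of automorphisms is closed if it is closed for pointwise convergence. -/
def IsClosedSubgroup (Γ : Subgroup G.Aut) : Prop := IsClosed[G.autTopology] (Γ : Set G.Aut)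

/-- Transitivity of a group of automorphisms on the vertices. -/
def IsTransitive (Γ : Subgroup G.Aut) : Prop := ∀ x y : V, ∃ γ ∈ Γ, Aut.vert γ x = y

/-- The orbit of `y` under the stabilizer of `x` in `Γ`. -/
def stabOrbit (Γ : Subgroup G.Aut) (x y : V) : Set V :=
  {z | ∃ γ ∈ Γ, Aut.vert γ x = x ∧ Aut.vert γ y = z}

/-- A transitive group `Γ` of automorphisms is unimodular if its modular function
`Δ(x, y) = |Stab_y x| / |Stab_x y|` is identically `1`. (These orbits are finite when the graph is
connected, because weights are preserved and only finitely many edges at a vertex have weight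
bounded below.) -/
def IsUnimodular (Γ : Subgroup G.Aut) : Prop :=
  ∀ x y : V, (stabOrbit Γ x y).encard = (stabOrbit Γ y x).encard

/-- Invariance of the law `μ` of an environment under the action `(γ p)_e = p_{γ⁻¹ e}`. -/
def IsInvariantEnv (Γ : Subgroup G.Aut) (μ : Measure (E → I)) : Prop :=
  ∀ γ ∈ Γ, μ.map (fun p e => p ((Aut.edge γ).symm e)) = μ

/-- The open edges determined by the environment `p` and the labels `U`. -/
def openEdges (p U : E → I) : Set E := {e | U e ≤ p e}

/-- The joint law of the environment `p`, sampled from `μ`, and of the random set of open edges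
obtained from `p` and independent i.i.d. uniform labels. -/
noncomputable def percLaw (μ : Measure (E → I)) : Measure ((E → I) × Set E) :=
  (μ.prod (Measure.infinitePi fun _ : E => (volume : Measure I))).map
    fun x => (x.1, openEdges x.1 x.2)

theorem measurable_openEdges :
    Measurable fun x : (E → I) × (E → I) => (x.1, openEdges x.1 x.2) := by
  refine measurable_fst.prodMk ?_
  refine measurable_pi_iff.2 fun e => ?_
  refine measurableSet_setOfPred.1 ?_
  exact measurableSet_le (by fun_prop) (by fun_prop)

instance (μ : Measure (E → I)) [IsProbabilityMeasure μ] : IsProbabilityMeasure (percLaw μ) :=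
  Measure.isProbabilityMeasure_map measurable_openEdges.aemeasurable

variable (G)

/-- The cluster of `v` in the configuration `ω` of open edges, as a set of vertices. -/
def cluster (ω : Set E) (v : V) : Set V := {u | (G.subgraph ω).Reachable v u}

/-- The endpoints of `e` lie in distinct clusters, each with at least `n` vertices and at least one
of them finite. -/
def TwoArm (e : E) (n : ℕ) (ω : Set E) : Prop :=
  ∃ x y : V, G.ends e = s(x, y) ∧ G.cluster ω x ≠ G.cluster ω y ∧
    (n : ℕ∞) ≤ (G.cluster ω x).encard ∧ (n : ℕ∞) ≤ (G.cluster ω y).encard ∧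
    ((G.cluster ω x).Finite ∨ (G.cluster ω y).Finite)

/-- The odds ratio `t / (1 - t)`, equal to `∞` at `t = 1`. -/
noncomputable def odds (t : I) : ℝ≥0∞ := ENNReal.ofReal t / ENNReal.ofReal (1 - t)

/-- The expectation of `√(p_e / (1 - p_e))` on the two-arm event at `e`. -/
noncomputable def twoArmExpectation (μ : Measure (E → I)) (e : E) (n : ℕ) : ℝ≥0∞ :=
  ∫⁻ x, {x : (E → I) × Set E | G.TwoArm e n x.2}.indicator
    (fun x => odds (x.1 e) ^ (1 / 2 : ℝ)) x ∂(percLaw μ)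

end WeightedGraph

/-!
# The improved two-ghost inequality

The proof compares the two-arm event with a martingale attached to the exploration of a single
cluster. Fix an invariant function `F ≥ 0` on the edges with finitely many non-zero values at each
vertex. An open edge `e` contributes `F e * √((1 - p e) / p e)` and a closed edge
`-F e * √(p e / (1 - p e))`; given the environment `p`, these increments are independent, with mean
zero and variance at most `F e ^ 2`.

*From two arms to one cluster.* Give each vertex of a cluster with `k` vertices the weight
`1 / max(n, k)`, and weight `0` if the cluster is infinite, so that a finite cluster has total
weight `min(n, k) / n`. Opening an edge between two clusters never increases their total weight, and lowers
it by at least one if both have at least `n` vertices and one of them is finite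
(`edgeMass_insert_add_le`). Resampling the state of `e` turns this into a lower bound, by
`F e` times the two-arm expectation, for the difference between the weights met by the closed and by
the open increments of `e` (`lintegral_openPart_add_le`). The mass transport principle
(`tsum_transport`) rewrites the sum of these differences over the edges at `o` as a
weighted expectation over the cluster of `o` of its discrepancy, the closed minus the open sum
(`two_mul_lintegral_sizeWeight_mul`, `tsum_twoArmExpectation_le`).

*The discrepancy of one cluster.* Up to sign the discrepancy of a finite cluster is the final value
`Z` of the martingale of an edge-by-edge exploration. For a decreasing weight `w` the expectation of
`w(|K|) Z ^ 2` is at most the variance `B` of the edges at one vertex times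
`∑ j, w(j) * P(|K| ≥ j)`: discounting by the number of vertices found so far gives a supermartingale
(`Exploration.potential_step`), and Fatou's lemma passes to the limit (`lintegral_sub_sq_le`).
With `w(k) = k ^ (-1/2)` for `k ≤ n` and `w(k)` proportional to `k ^ (-2)` for `k > n`, the
Cauchy–Schwarz inequality and the tail hypothesis, used once in each factor, bound the discrepancy
by a constant times `A * √B * n ^ (-1/2 - θ)` (`sq_lintegral_sizeWeight_mul_le`).

*Conclusion.* Take for `F` the two-arm expectation itself, restricted to edges of weight bounded
below. The linear estimate then reads `B ≤ C * √B`, which bounds `B` (`sum_sq_le`), and the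
restriction on the edges is removed by exhaustion.
-/

namespace WeightedGraph

variable {V E : Type*} {G : WeightedGraph V E}

/-! ### Clusters -/

theorem mem_cluster_self (ω : Set E) (v : V) : v ∈ G.cluster ω v :=
  SimpleGraph.Reachable.refl v

theorem mem_cluster_comm {ω : Set E} {u v : V} : u ∈ G.cluster ω v ↔ v ∈ G.cluster ω u :=
  ⟨SimpleGraph.Reachable.symm, SimpleGraph.Reachable.symm⟩

theorem cluster_eq_of_mem {ω : Set E} {u v : V} (h : u ∈ G.cluster ω v) :
    G.cluster ω u = G.cluster ω v :=
  Set.ext fun _ => ⟨fun hw => SimpleGraph.Reachable.trans h hw,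
    fun hw => SimpleGraph.Reachable.trans (SimpleGraph.Reachable.symm h) hw⟩

theorem cluster_mono {ω ω' : Set E} (h : ω ⊆ ω') (v : V) : G.cluster ω v ⊆ G.cluster ω' v :=
  fun _ hu => SimpleGraph.Reachable.mono
    (SimpleGraph.fromEdgeSet_mono (Set.image_mono h)) hu

theorem mem_cluster_of_ends {ω : Set E} {e : E} {x y : V} (he : e ∈ ω) (hxy : G.ends e = s(x, y)) :
    y ∈ G.cluster ω x := by
  by_cases h : x = y
  · subst h; exact mem_cluster_self ω x
  · refine SimpleGraph.Adj.reachable ?_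
    rw [subgraph, SimpleGraph.fromEdgeSet_adj]
    exact ⟨⟨e, he, hxy⟩, h⟩

theorem cluster_subset_of_closed {ω : Set E} {v : V} {C : Set V} (hv : v ∈ C)
    (hC : ∀ e ∈ ω, ∀ x y, G.ends e = s(x, y) → x ∈ C → y ∈ C) : G.cluster ω v ⊆ C := by
  rintro u ⟨w⟩
  induction w with
  | nil => exact hv
  | cons hadj _ ih =>
    rw [subgraph, SimpleGraph.fromEdgeSet_adj] at hadj
    obtain ⟨⟨e, he, hxy⟩, -⟩ := hadj
    exact ih (hC e he _ _ hxy hv)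

theorem cluster_eq_or_disjoint (ω : Set E) (x y : V) :
    G.cluster ω x = G.cluster ω y ∨ Disjoint (G.cluster ω x) (G.cluster ω y) := by
  by_cases h : Disjoint (G.cluster ω x) (G.cluster ω y)
  · exact Or.inr h
  · obtain ⟨u, hu, hu'⟩ := Set.not_disjoint_iff.1 h
    exact Or.inl ((cluster_eq_of_mem hu).symm.trans (cluster_eq_of_mem hu'))

theorem cluster_insert {ω : Set E} {e : E} {x y : V} (hxy : G.ends e = s(x, y)) :
    G.cluster (insert e ω) x = G.cluster ω x ∪ G.cluster ω y := by
  apply subset_antisymm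
  · refine cluster_subset_of_closed (Or.inl (mem_cluster_self _ _)) ?_
    rintro e' (rfl | he') a b hab ha
    · rw [hxy, Sym2.eq_iff] at hab
      rcases hab with ⟨rfl, rfl⟩ | ⟨rfl, rfl⟩
      · exact Or.inr (mem_cluster_self _ _)
      · exact Or.inl (mem_cluster_self _ _)
    · have hb := mem_cluster_of_ends he' hab
      rcases ha with ha | ha
      · exact Or.inl (SimpleGraph.Reachable.trans ha hb)
      · exact Or.inr (SimpleGraph.Reachable.trans ha hb)
  · have hy : y ∈ G.cluster (insert e ω) x := mem_cluster_of_ends (Set.mem_insert _ _) hxy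
    refine Set.union_subset (cluster_mono (Set.subset_insert _ _) _) ?_
    rw [← cluster_eq_of_mem hy]
    exact cluster_mono (Set.subset_insert _ _) _

/-- Connections are realised by finitely many open edges. -/
theorem mem_cluster_iff_exists_finset {ω : Set E} {u v : V} :
    u ∈ G.cluster ω v ↔ ∃ S : Finset E, (S : Set E) ⊆ ω ∧ u ∈ G.cluster (S : Set E) v := by
  classical
  constructor
  · refine fun h => cluster_subset_of_closed
      (C := {u | ∃ S : Finset E, (S : Set E) ⊆ ω ∧ u ∈ G.cluster (S : Set E) v})
      ⟨∅, by simp, mem_cluster_self _ _⟩ ?_ h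
    rintro e he x y hxy ⟨S, hS, hx⟩
    refine ⟨insert e S, ?_, ?_⟩
    · rw [Finset.coe_insert]; exact Set.insert_subset he hS
    · rw [Finset.coe_insert]
      exact SimpleGraph.Reachable.trans (cluster_mono (Set.subset_insert _ _) _ hx)
        (mem_cluster_of_ends (Set.mem_insert _ _) hxy)
  · rintro ⟨S, hS, h⟩
    exact cluster_mono hS _ h

/-! ### Measurability of cluster events -/

theorem measurableSet_mem_cluster [Countable E] (u v : V) :
    MeasurableSet {ω : Set E | u ∈ G.cluster ω v} := by
  have : {ω : Set E | u ∈ G.cluster ω v} =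
      ⋃ S : {S : Finset E // u ∈ G.cluster (S : Set E) v}, ⋂ e ∈ S.1, {ω : Set E | e ∈ ω} := by
    ext ω
    simp only [Set.mem_ofPred_eq, mem_cluster_iff_exists_finset (ω := ω), Set.mem_iUnion,
      Set.mem_iInter, Subtype.exists]
    exact ⟨fun ⟨S, hS, h⟩ => ⟨S, h, fun e he => hS he⟩, fun ⟨S, h, hS⟩ => ⟨S, hS, h⟩⟩
  rw [this]
  refine MeasurableSet.iUnion fun S => Finset.measurableSet_biInter _ fun e _ => ?_
  exact measurableSet_setOfPred.2 (measurable_set_mem e)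

theorem measurableSet_le_encard_cluster [Countable V] [Countable E] (k : ℕ) (v : V) :
    MeasurableSet {ω : Set E | (k : ℕ∞) ≤ (G.cluster ω v).encard} := by
  have : {ω : Set E | (k : ℕ∞) ≤ (G.cluster ω v).encard} =
      ⋃ T : {T : Finset V // T.card = k}, ⋂ u ∈ T.1, {ω : Set E | u ∈ G.cluster ω v} := by
    ext ω
    simp only [Set.mem_ofPred_eq, Set.mem_iUnion, Set.mem_iInter, Subtype.exists]
    constructor
    · intro h
      obtain ⟨T, hT, hk⟩ := Set.exists_subset_encard_eq h
      have hfin : T.Finite := Set.finite_of_encard_eq_coe hk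
      refine ⟨hfin.toFinset, ?_, fun u hu => hT (by simpa using hu)⟩
      rw [hfin.encard_eq_coe_toFinset_card] at hk
      exact_mod_cast hk
    · rintro ⟨T, rfl, hT⟩
      rw [← Set.encard_coe_eq_coe_finsetCard]
      exact Set.encard_le_encard fun u hu => hT u hu
  rw [this]
  exact MeasurableSet.iUnion fun T => Finset.measurableSet_biInter _ fun u _ =>
    measurableSet_mem_cluster u v

theorem measurable_encard_cluster [Countable V] [Countable E] (v : V) :
    Measurable fun ω : Set E => (G.cluster ω v).encard := by
  rw [ENat.measurable_iff]
  intro k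
  have : (fun ω : Set E => (G.cluster ω v).encard) ⁻¹' {(k : ℕ∞)} =
      {ω : Set E | (k : ℕ∞) ≤ (G.cluster ω v).encard} \
        {ω : Set E | ((k + 1 : ℕ) : ℕ∞) ≤ (G.cluster ω v).encard} := by
    ext ω
    simp only [Set.mem_preimage, Set.mem_singleton_iff, Set.mem_sdiff, Set.mem_ofPred_eq, not_le,
      Nat.cast_add, Nat.cast_one]
    rw [ENat.lt_add_one_iff (ENat.natCast_ne_top k)]
    exact ⟨fun h => ⟨h.ge, h.le⟩, fun h => le_antisymm h.2 h.1⟩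
  rw [this]
  exact (measurableSet_le_encard_cluster k v).diff (measurableSet_le_encard_cluster (k + 1) v)

theorem cluster_ne_iff {ω : Set E} {x y : V} :
    G.cluster ω x ≠ G.cluster ω y ↔ y ∉ G.cluster ω x :=
  not_congr ⟨fun h => h ▸ mem_cluster_self ω y, fun h => (cluster_eq_of_mem h).symm⟩

theorem measurableSet_finite_cluster [Countable V] [Countable E] (v : V) :
    MeasurableSet {ω : Set E | (G.cluster ω v).Finite} := by
  simp_rw [← Set.encard_ne_top_iff]
  exact (measurable_encard_cluster v) (MeasurableSet.of_discrete (s := {k : ℕ∞ | k ≠ ⊤}))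

theorem measurableSet_twoArm [Countable V] [Countable E] (e : E) (n : ℕ) :
    MeasurableSet {ω : Set E | G.TwoArm e n ω} := by
  simp only [TwoArm, cluster_ne_iff, Set.ofPred_exists, Set.ofPred_and, Set.ofPred_or]
  refine MeasurableSet.iUnion fun x => MeasurableSet.iUnion fun y => ?_
  exact (MeasurableSet.const _).inter ((measurableSet_mem_cluster y x).compl.inter
    ((measurableSet_le_encard_cluster n x).inter ((measurableSet_le_encard_cluster n y).inter
      ((measurableSet_finite_cluster x).union (measurableSet_finite_cluster y)))))

/-! ### Cluster weights -/

/-- The weight `1 / max(n, k)` attached to each vertex of a cluster with `k` vertices; it vanishes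
on infinite clusters. -/
noncomputable def sizeWeight (n : ℕ) (k : ℕ∞) : ℝ≥0∞ := ((max (n : ℕ∞) k : ℕ∞) : ℝ≥0∞)⁻¹

/-- The total weight `min(n, k) / n` of a finite cluster with `k` vertices, and `0` for an infinite
cluster. -/
noncomputable def totalWeight (n : ℕ) (k : ℕ∞) : ℝ≥0∞ := (k : ℝ≥0∞) * sizeWeight n k

@[simp] theorem sizeWeight_top (n : ℕ) : sizeWeight n ⊤ = 0 := by simp [sizeWeight]

@[simp] theorem totalWeight_top (n : ℕ) : totalWeight n ⊤ = 0 := by simp [totalWeight]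

theorem totalWeight_coe {n : ℕ} (hn : 1 ≤ n) (k : ℕ) :
    totalWeight n k = ENNReal.ofReal (min (n : ℝ) k / n) := by
  have hn' : (0 : ℝ) < n := by exact_mod_cast hn
  have hmax : (0 : ℝ) < max (n : ℝ) k := lt_max_of_lt_left hn'
  have h1 : ((max (n : ℕ∞) k : ℕ∞) : ℝ≥0∞) = ENNReal.ofReal (max (n : ℝ) k) := by
    rw [ENat.toENNReal_max, ENNReal.ofReal_max]
    simp
  rw [totalWeight, sizeWeight, h1, ← ENNReal.ofReal_inv_of_pos hmax, ENat.toENNReal_coe,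
    ← ENNReal.ofReal_natCast, ← ENNReal.ofReal_mul (by positivity)]
  congr 1
  rcases le_total (n : ℝ) k with h | h
  · rw [max_eq_right h, min_eq_left h, div_self hn'.ne']
    exact mul_inv_cancel₀ (hn'.trans_le h).ne'
  · rw [max_eq_left h, min_eq_right h]; rfl

theorem totalWeight_le_one {n : ℕ} (hn : 1 ≤ n) (k : ℕ∞) : totalWeight n k ≤ 1 := by
  induction k with
  | top => simp
  | coe k =>
    rw [totalWeight_coe hn, ENNReal.ofReal_le_one]
    have hn' : (0 : ℝ) < n := by exact_mod_cast hn
    exact (div_le_one hn').2 (min_le_left _ _)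

theorem totalWeight_of_le {n : ℕ} (hn : 1 ≤ n) {k : ℕ∞} (hk : k ≠ ⊤) (hnk : (n : ℕ∞) ≤ k) :
    totalWeight n k = 1 := by
  lift k to ℕ using hk
  have hn' : (0 : ℝ) < n := by exact_mod_cast hn
  have : (n : ℝ) ≤ k := by exact_mod_cast hnk
  rw [totalWeight_coe hn, min_eq_left this, div_self hn'.ne', ENNReal.ofReal_one]

theorem totalWeight_add_le {n : ℕ} (hn : 1 ≤ n) (k l : ℕ∞) :
    totalWeight n (k + l) ≤ totalWeight n k + totalWeight n l := by
  induction k with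
  | top => simp
  | coe k =>
    induction l with
    | top => simp
    | coe l =>
      have hn' : (0 : ℝ) < n := by exact_mod_cast hn
      rw [← Nat.cast_add, totalWeight_coe hn, totalWeight_coe hn, totalWeight_coe hn,
        ← ENNReal.ofReal_add (by positivity) (by positivity), ← add_div]
      refine ENNReal.ofReal_le_ofReal (div_le_div_of_nonneg_right ?_ hn'.le)
      push_cast
      have hk : (0 : ℝ) ≤ k := by positivity
      have hl : (0 : ℝ) ≤ l := by positivity
      rcases le_total (n : ℝ) k with h | h <;> rcases le_total (n : ℝ) l with h' | h' <;>
        simp only [min_eq_left h, min_eq_right h, min_eq_left h', min_eq_right h'] <;>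
        first
          | exact min_le_right _ _
          | exact (min_le_left _ _).trans (by linarith)

/-- Merging two clusters, both of size at least `n` and at least one of them finite, lowers the
total weight by at least one. -/
theorem totalWeight_add_add_one_le {n : ℕ} (hn : 1 ≤ n) {k l : ℕ∞} (hk : (n : ℕ∞) ≤ k)
    (hl : (n : ℕ∞) ≤ l) (hkl : k ≠ ⊤ ∨ l ≠ ⊤) :
    totalWeight n (k + l) + 1 ≤ totalWeight n k + totalWeight n l := by
  by_cases hk' : k = ⊤
  · subst hk'
    have hl' : l ≠ ⊤ := by simpa using hkl
    simp [totalWeight_of_le hn hl' hl]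
  · by_cases hl' : l = ⊤
    · subst hl'
      simp [totalWeight_of_le hn hk' hk]
    · rw [totalWeight_of_le hn hk' hk, totalWeight_of_le hn hl' hl]
      gcongr
      exact totalWeight_le_one hn _

open Classical in
/-- The sum of the vertex weights over all vertices whose cluster contains an endpoint of `e`. -/
noncomputable def edgeMass (G : WeightedGraph V E) (n : ℕ) (ω : Set E) (e : E) : ℝ≥0∞ :=
  ∑' v, if ∃ u ∈ G.cluster ω v, u ∈ G.ends e then sizeWeight n (G.cluster ω v).encard else 0

theorem tsum_sizeWeight_cluster (n : ℕ) (ω : Set E) (x : V) :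
    ∑' v : G.cluster ω x, sizeWeight n (G.cluster ω v).encard
      = totalWeight n (G.cluster ω x).encard := by
  rw [totalWeight, ← ENNReal.tsum_set_const]
  exact tsum_congr fun v => by rw [cluster_eq_of_mem v.2]

theorem edgeMass_eq_tsum {n : ℕ} {ω : Set E} {e : E} {x y : V} (hxy : G.ends e = s(x, y)) :
    edgeMass G n ω e =
      ∑' v : ↥(G.cluster ω x ∪ G.cluster ω y), sizeWeight n (G.cluster ω v).encard := by
  classical
  rw [edgeMass, tsum_subtype (G.cluster ω x ∪ G.cluster ω y)
    (fun v => sizeWeight n (G.cluster ω v).encard)]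
  refine tsum_congr fun v => ?_
  rw [Set.indicator_apply]
  congr 1
  rw [hxy]
  simp only [Sym2.mem_iff, Set.mem_union, eq_iff_iff]
  constructor
  · rintro ⟨u, hu, rfl | rfl⟩
    · exact Or.inl (mem_cluster_comm.1 hu)
    · exact Or.inr (mem_cluster_comm.1 hu)
  · rintro (h | h)
    · exact ⟨x, mem_cluster_comm.1 h, Or.inl rfl⟩
    · exact ⟨y, mem_cluster_comm.1 h, Or.inr rfl⟩

theorem edgeMass_of_eq {n : ℕ} {ω : Set E} {e : E} {x y : V} (hxy : G.ends e = s(x, y))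
    (h : G.cluster ω x = G.cluster ω y) :
    edgeMass G n ω e = totalWeight n (G.cluster ω x).encard := by
  rw [edgeMass_eq_tsum hxy, ← h, Set.union_self, tsum_sizeWeight_cluster]

theorem edgeMass_of_ne {n : ℕ} {ω : Set E} {e : E} {x y : V} (hxy : G.ends e = s(x, y))
    (h : G.cluster ω x ≠ G.cluster ω y) :
    edgeMass G n ω e =
      totalWeight n (G.cluster ω x).encard + totalWeight n (G.cluster ω y).encard := by
  have hd := (cluster_eq_or_disjoint ω x y).resolve_left h
  rw [edgeMass_eq_tsum hxy, ENNReal.summable.tsum_union_disjoint (f := fun v =>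
    sizeWeight n (G.cluster ω v).encard) hd ENNReal.summable, tsum_sizeWeight_cluster,
    tsum_sizeWeight_cluster]

theorem edgeMass_le_two {n : ℕ} (hn : 1 ≤ n) (ω : Set E) (e : E) : edgeMass G n ω e ≤ 2 := by
  obtain ⟨x, y, hxy⟩ : ∃ x y, G.ends e = s(x, y) := by
    induction h : G.ends e with
    | h x y => exact ⟨x, y, rfl⟩
  by_cases h : G.cluster ω x = G.cluster ω y
  · rw [edgeMass_of_eq hxy h]
    exact (totalWeight_le_one hn _).trans one_le_two
  · rw [edgeMass_of_ne hxy h, ← one_add_one_eq_two]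
    exact add_le_add (totalWeight_le_one hn _) (totalWeight_le_one hn _)

/-- Opening an edge never increases the mass of the clusters at its endpoints, and decreases it by
at least one when the two-arm event holds with the edge closed. -/
theorem edgeMass_insert_add_le {n : ℕ} (hn : 1 ≤ n) (ω : Set E) (e : E) :
    edgeMass G n (insert e ω) e + {ω | G.TwoArm e n ω}.indicator 1 ω ≤ edgeMass G n ω e := by
  classical
  obtain ⟨x, y, hxy⟩ : ∃ x y, G.ends e = s(x, y) := by
    induction h : G.ends e with
    | h x y => exact ⟨x, y, rfl⟩
  have hy : G.cluster (insert e ω) x = G.cluster (insert e ω) y :=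
    (cluster_eq_of_mem (mem_cluster_of_ends (Set.mem_insert _ _) hxy)).symm
  rw [edgeMass_of_eq hxy hy, cluster_insert hxy]
  by_cases hA : G.TwoArm e n ω
  · rw [Set.indicator_of_mem (by exact hA), Pi.one_apply]
    obtain ⟨a, b, hab, hne, ha, hb, hfin⟩ := hA
    rw [← Set.encard_ne_top_iff, ← Set.encard_ne_top_iff] at hfin
    have key := totalWeight_add_add_one_le hn ha hb hfin
    have hd := (cluster_eq_or_disjoint ω a b).resolve_left hne
    rw [← Set.encard_union_eq hd, ← edgeMass_of_ne hab hne] at key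
    rw [hxy, Sym2.eq_iff] at hab
    rcases hab with ⟨rfl, rfl⟩ | ⟨rfl, rfl⟩
    · exact key
    · rwa [Set.union_comm]
  · rw [Set.indicator_of_notMem (by exact hA), add_zero]
    by_cases h : G.cluster ω x = G.cluster ω y
    · rw [edgeMass_of_eq hxy h, ← h, Set.union_self]
    · rw [edgeMass_of_ne hxy h,
        Set.encard_union_eq ((cluster_eq_or_disjoint ω x y).resolve_left h)]
      exact totalWeight_add_le hn _ _

theorem measurable_sizeWeight_cluster [Countable V] [Countable E] (n : ℕ) (v : V) :
    Measurable fun ω : Set E => sizeWeight n (G.cluster ω v).encard :=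
  (Measurable.of_discrete (f := sizeWeight n)).comp (measurable_encard_cluster v)

theorem measurableSet_touches [Countable V] [Countable E] (e : E) (v : V) :
    MeasurableSet {ω : Set E | ∃ u ∈ G.cluster ω v, u ∈ G.ends e} := by
  simp only [Set.ofPred_exists, Set.ofPred_and]
  exact MeasurableSet.iUnion fun u =>
    (measurableSet_mem_cluster u v).inter (MeasurableSet.const _)

theorem measurable_edgeMass [Countable V] [Countable E] (n : ℕ) (e : E) :
    Measurable fun ω : Set E => edgeMass G n ω e :=
  Measurable.tsum fun v => Measurable.ite (measurableSet_touches e v)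
    (measurable_sizeWeight_cluster n v) measurable_const

/-! ### Resampling the state of a single edge -/

/-- The law of i.i.d. uniform labels on the edges. -/
noncomputable abbrev labelLaw (E : Type*) : Measure (E → I) :=
  Measure.infinitePi fun _ : E => (volume : Measure I)

/-- The law of the set of open edges in the fixed environment `p`: independent Bernoulli
percolation with edge probabilities `p`. -/
noncomputable def quenchedLaw (p : E → I) : Measure (Set E) := (labelLaw E).map (openEdges p)

theorem measurable_openEdges_right (p : E → I) : Measurable (openEdges p) :=
  (measurable_snd.comp measurable_openEdges).comp measurable_prodMk_left

instance (p : E → I) : IsProbabilityMeasure (quenchedLaw p) :=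
  Measure.isProbabilityMeasure_map (measurable_openEdges_right p).aemeasurable

open Classical in
theorem measurable_update_prod (e : E) :
    Measurable fun x : I × (E → I) => Function.update x.2 e x.1 := by
  refine measurable_pi_iff.2 fun a => ?_
  by_cases h : a = e
  · subst h; simpa using measurable_fst
  · simp only [Function.update_of_ne h]
    exact (measurable_pi_apply a).comp measurable_snd

open Classical in
theorem map_update_labelLaw (e : E) :
    ((volume : Measure I).prod (labelLaw E)).map (fun x => Function.update x.2 e x.1)
      = labelLaw E := by
  have hm := measurable_update_prod (E := E) e
  refine Measure.eq_infinitePi _ fun s t ht => ?_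
  rw [Measure.map_apply hm (MeasurableSet.pi s.countable_toSet fun i _ => ht i)]
  have hpre : (fun x : I × (E → I) => Function.update x.2 e x.1) ⁻¹' ((s : Set E).pi t) =
      (if e ∈ s then t e else Set.univ) ×ˢ (((s.erase e : Finset E) : Set E).pi t) := by
    ext ⟨u, U⟩
    simp only [Set.mem_preimage, Set.mem_pi, Finset.mem_coe, Set.mem_prod, Finset.mem_erase]
    constructor
    · intro h
      refine ⟨?_, fun i hi => by simpa [Function.update_of_ne hi.1] using h i hi.2⟩
      split_ifs with he
      · simpa using h e he
      · trivial
    · rintro ⟨h1, h2⟩ i hi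
      by_cases hie : i = e
      · subst hie; rw [if_pos hi] at h1; simpa using h1
      · simpa [Function.update_of_ne hie] using h2 i ⟨hie, hi⟩
  rw [hpre, Measure.prod_prod, Measure.infinitePi_pi _ fun i _ => ht i]
  split_ifs with he
  · exact Finset.mul_prod_erase s (fun i => volume (t i)) he
  · rw [measure_univ, one_mul, Finset.erase_eq_of_notMem he]

theorem measurable_insert_set (e : E) : Measurable fun ω : Set E => insert e ω := by
  refine measurable_set_iff.2 fun a => ?_
  by_cases h : a = e
  · subst h; simp
  · simpa [h] using measurable_set_mem a

theorem measurable_sdiff_singleton_set (e : E) : Measurable fun ω : Set E => ω \ {e} := by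
  refine measurable_set_iff.2 fun a => ?_
  by_cases h : a = e
  · subst h; simp
  · simpa [h] using measurable_set_mem a

theorem lintegral_labelLaw_resample (p : E → I) (e : E) {h : Set E → ℝ≥0∞} (hh : Measurable h) :
    ∫⁻ U, h (openEdges p U) ∂(labelLaw E) =
      ENNReal.ofReal (p e) * ∫⁻ U, h (insert e (openEdges p U)) ∂(labelLaw E) +
      ENNReal.ofReal (1 - p e) * ∫⁻ U, h (openEdges p U \ {e}) ∂(labelLaw E) := by
  classical
  have hm := measurable_update_prod (E := E) e
  have ho := measurable_openEdges_right p
  conv_lhs => rw [← map_update_labelLaw e]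
  rw [lintegral_map (f := fun U => h (openEdges p U)) (hh.comp ho) hm,
    lintegral_prod (fun x : I × (E → I) => h (openEdges p (Function.update x.2 e x.1)))
      ((hh.comp ho).comp hm).aemeasurable]
  have hu : ∀ (u : I) (U : E → I), openEdges p (Function.update U e u) =
      if u ≤ p e then insert e (openEdges p U) else openEdges p U \ {e} := by
    intro u U
    ext a
    by_cases hae : a = e
    · subst hae; by_cases hup : u ≤ p a <;> simp [openEdges, hup]
    · by_cases hup : u ≤ p e <;> simp [openEdges, hup, hae]
  simp_rw [hu]
  have hs : ∀ u : I, ∫⁻ U, h (if u ≤ p e then insert e (openEdges p U) else openEdges p U \ {e})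
        ∂(labelLaw E) =
      (Set.Iic (p e)).indicator
        (fun _ => ∫⁻ U, h (insert e (openEdges p U)) ∂(labelLaw E)) u +
      (Set.Ioi (p e)).indicator
        (fun _ => ∫⁻ U, h (openEdges p U \ {e}) ∂(labelLaw E)) u := by
    intro u
    by_cases hup : u ≤ p e
    · simp [hup]
    · simp [hup, not_le.1 hup]
  simp_rw [hs]
  rw [lintegral_add_left (measurable_const.indicator measurableSet_Iic),
    lintegral_indicator measurableSet_Iic, lintegral_indicator measurableSet_Ioi,
    setLIntegral_const, setLIntegral_const, unitInterval.volume_Iic, unitInterval.volume_Ioi,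
    mul_comm, mul_comm (∫⁻ U, h (openEdges p U \ {e}) ∂(labelLaw E))]

/-- In a fixed environment the state of `e` is open with probability `p e`, independently of all
other edges. -/
theorem quenchedLaw_resample (p : E → I) (e : E) :
    quenchedLaw p = ENNReal.ofReal (p e) • (quenchedLaw p).map (fun ω => insert e ω) +
      ENNReal.ofReal (1 - p e) • (quenchedLaw p).map (fun ω => ω \ {e}) := by
  have ho := measurable_openEdges_right p
  ext s hs
  have key := lintegral_labelLaw_resample p e (measurable_one.indicator hs)
  rw [Measure.add_apply, Measure.smul_apply, Measure.smul_apply, quenchedLaw,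
    Measure.map_map (measurable_insert_set e) ho,
    Measure.map_map (measurable_sdiff_singleton_set e) ho,
    ← lintegral_indicator_one hs, ← lintegral_indicator_one hs, ← lintegral_indicator_one hs,
    lintegral_map (measurable_one.indicator hs) ho,
    lintegral_map (measurable_one.indicator hs) ((measurable_insert_set e).comp ho),
    lintegral_map (measurable_one.indicator hs) ((measurable_sdiff_singleton_set e).comp ho)]
  exact key

theorem lintegral_quenchedLaw_resample (p : E → I) (e : E) {h : Set E → ℝ≥0∞}
    (hh : Measurable h) :
    ∫⁻ ω, h ω ∂(quenchedLaw p) =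
      ENNReal.ofReal (p e) * ∫⁻ ω, h (insert e ω) ∂(quenchedLaw p) +
      ENNReal.ofReal (1 - p e) * ∫⁻ ω, h (ω \ {e}) ∂(quenchedLaw p) := by
  conv_lhs => rw [quenchedLaw_resample p e]
  rw [lintegral_add_measure, lintegral_smul_measure, lintegral_smul_measure,
    lintegral_map hh (measurable_insert_set e),
    lintegral_map hh (measurable_sdiff_singleton_set e), smul_eq_mul, smul_eq_mul]

theorem integral_quenchedLaw_resample (p : E → I) (e : E) {h : Set E → ℝ} (hh : Measurable h)
    (h1 : Integrable (fun ω => h (insert e ω)) (quenchedLaw p))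
    (h2 : Integrable (fun ω => h (ω \ {e})) (quenchedLaw p)) :
    ∫ ω, h ω ∂(quenchedLaw p) =
      p e * ∫ ω, h (insert e ω) ∂(quenchedLaw p) +
      (1 - p e) * ∫ ω, h (ω \ {e}) ∂(quenchedLaw p) := by
  have i1 : Integrable h (ENNReal.ofReal (p e) • (quenchedLaw p).map (fun ω => insert e ω)) :=
    ((integrable_map_measure hh.aestronglyMeasurable
      (measurable_insert_set e).aemeasurable).2 h1).smul_measure ENNReal.ofReal_ne_top
  have i2 : Integrable h (ENNReal.ofReal (1 - p e) • (quenchedLaw p).map (fun ω => ω \ {e})) :=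
    ((integrable_map_measure hh.aestronglyMeasurable
      (measurable_sdiff_singleton_set e).aemeasurable).2 h2).smul_measure ENNReal.ofReal_ne_top
  conv_lhs => rw [quenchedLaw_resample p e]
  rw [integral_add_measure i1 i2, integral_smul_measure, integral_smul_measure,
    integral_map (measurable_insert_set e).aemeasurable hh.aestronglyMeasurable,
    integral_map (measurable_sdiff_singleton_set e).aemeasurable hh.aestronglyMeasurable,
    ENNReal.toReal_ofReal (p e).2.1, ENNReal.toReal_ofReal (sub_nonneg.2 (p e).2.2),
    smul_eq_mul, smul_eq_mul]

/-! ### Exploring a cluster edge by edge -/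

/-- The increment of the exploration martingale at an open edge. It is `0` when `p e = 0`. -/
noncomputable def openIncr (p : E → I) (F : E → ℝ) (e : E) : ℝ := F e * √((1 - p e) / p e)

/-- Minus the increment of the exploration martingale at a closed edge. It is `0` when
`p e = 1`. -/
noncomputable def closedIncr (p : E → I) (F : E → ℝ) (e : E) : ℝ := F e * √(p e / (1 - p e))

theorem mul_openIncr_eq (p : E → I) (F : E → ℝ) (e : E) :
    p e * openIncr p F e = F e * √(p e * (1 - p e)) := by
  have h0 : (0 : ℝ) ≤ p e := (p e).2.1
  rcases h0.eq_or_lt with h | h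
  · simp [openIncr, ← h]
  · have : p e * (1 - p e) = (p e : ℝ) ^ 2 * ((1 - p e) / p e) := by field_simp
    rw [this, Real.sqrt_mul (sq_nonneg _), Real.sqrt_sq h0, openIncr]
    ring

theorem mul_closedIncr_eq (p : E → I) (F : E → ℝ) (e : E) :
    (1 - p e) * closedIncr p F e = F e * √(p e * (1 - p e)) := by
  have h0 : (0 : ℝ) ≤ 1 - p e := sub_nonneg.2 (p e).2.2
  rcases h0.eq_or_lt with h | h
  · simp [closedIncr, ← h]
  · have : p e * (1 - p e) = (1 - p e : ℝ) ^ 2 * (p e / (1 - p e)) := by field_simp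
    rw [this, Real.sqrt_mul (sq_nonneg _), Real.sqrt_sq h0, closedIncr]
    ring

theorem variance_incr_le (p : E → I) (F : E → ℝ) (e : E) :
    p e * openIncr p F e ^ 2 + (1 - p e) * closedIncr p F e ^ 2 ≤ F e ^ 2 := by
  have h0 : (0 : ℝ) ≤ p e := (p e).2.1
  have h1 : (0 : ℝ) ≤ 1 - p e := sub_nonneg.2 (p e).2.2
  rw [openIncr, closedIncr, mul_pow, mul_pow, Real.sq_sqrt (div_nonneg h1 h0),
    Real.sq_sqrt (div_nonneg h0 h1)]
  rcases h0.eq_or_lt with h | h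
  · simp [← h, sq_nonneg]
  rcases h1.eq_or_lt with h' | h'
  · simp [← h', sq_nonneg]
  · refine le_of_eq ?_
    field_simp
    ring

/-- A stage in the exploration of a cluster: the vertices found so far, the edges examined so far,
and the accumulated value of the martingale. -/
structure Exploration (V E : Type*) where
  found : Finset V
  examined : Finset E
  value : ℝ

namespace Exploration

open Classical in
/-- The stage reached from `st` when `e` is examined and turns out to be open. -/
noncomputable def examineOpen (G : WeightedGraph V E) (p : E → I) (F : E → ℝ)
    (st : Exploration V E) (e : E) : Exploration V E :=
  ⟨st.found ∪ (G.ends e).toFinset, insert e st.examined, st.value + openIncr p F e⟩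

open Classical in
/-- The stage reached from `st` when `e` is examined and turns out to be closed. -/
noncomputable def examineClosed (p : E → I) (F : E → ℝ) (st : Exploration V E) (e : E) :
    Exploration V E :=
  ⟨st.found, insert e st.examined, st.value - closedIncr p F e⟩

/-- An edge may be examined if it is new and touches a vertex already found. -/
def Admissible (G : WeightedGraph V E) (st : Exploration V E) (e : E) : Prop :=
  e ∉ st.examined ∧ ∃ u ∈ st.found, u ∈ G.ends e

open Classical in
/-- Examine `e` if this is admissible, and do nothing otherwise. -/
noncomputable def step (G : WeightedGraph V E) (p : E → I) (F : E → ℝ) (ω : Set E)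
    (st : Exploration V E) (e : E) : Exploration V E :=
  if st.Admissible G e then
    if e ∈ ω then st.examineOpen G p F e else st.examineClosed p F e
  else st

/-- Go through the edges of a list in order. -/
noncomputable def run (G : WeightedGraph V E) (p : E → I) (F : E → ℝ) (ω : Set E)
    (st : Exploration V E) (l : List E) : Exploration V E :=
  l.foldl (step G p F ω) st

theorem examined_subset_step (p : E → I) (F : E → ℝ) (ω : Set E) (st : Exploration V E) (e : E) :
    st.examined ⊆ (step G p F ω st e).examined := by
  classical
  rw [step]
  split_ifs
  · exact fun a ha => Finset.mem_insert_of_mem ha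
  · exact fun a ha => Finset.mem_insert_of_mem ha
  · exact subset_rfl

/-- Once an edge has been examined, its state has no further influence. -/
theorem run_congr {p : E → I} {F : E → ℝ} {ω ω' : Set E} {e : E}
    (h : ∀ a, a ≠ e → (a ∈ ω ↔ a ∈ ω')) (l : List E) (st : Exploration V E)
    (he : e ∈ st.examined) : run G p F ω st l = run G p F ω' st l := by
  induction l generalizing st with
  | nil => rfl
  | cons a l ih =>
    have hs : step G p F ω st a = step G p F ω' st a := by
      by_cases ha : a = e
      · subst ha
        have : ¬ st.Admissible G a := fun h => h.1 he
        rw [step, step, if_neg this, if_neg this]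
      · by_cases hω : a ∈ ω
        · simp only [step, hω, (h a ha).1 hω]
        · have hω' : a ∉ ω' := fun h' => hω ((h a ha).2 h')
          simp only [step, hω, hω']
    change run G p F ω (step G p F ω st a) l = run G p F ω' (step G p F ω' st a) l
    rw [← hs]
    exact ih _ (examined_subset_step p F ω st a he)

theorem measurable_run (p : E → I) (F : E → ℝ) {α : Type*} [MeasurableSpace α]
    (f : Exploration V E → α) (l : List E) (st : Exploration V E) :
    Measurable fun ω : Set E => f (run G p F ω st l) := by
  classical
  induction l generalizing st with
  | nil => exact measurable_const (a := f st)
  | cons a l ih =>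
    by_cases hadm : st.Admissible G a
    · have : (fun ω : Set E => f (run G p F ω st (a :: l))) = fun ω =>
          if a ∈ ω then f (run G p F ω (st.examineOpen G p F a) l)
          else f (run G p F ω (st.examineClosed p F a) l) := by
        funext ω
        change f (run G p F ω (step G p F ω st a) l) = _
        rw [step, if_pos hadm]
        split_ifs <;> rfl
      rw [this]
      exact Measurable.ite (measurableSet_setOfPred.2 (measurable_set_mem a)) (ih _) (ih _)
    · have : (fun ω : Set E => f (run G p F ω st (a :: l))) =
          fun ω => f (run G p F ω st l) := by
        funext ω
        change f (run G p F ω (step G p F ω st a) l) = _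
        rw [step, if_neg hadm]
      rw [this]
      exact ih _

theorem exists_norm_run_le (p : E → I) (F : E → ℝ) (f : Exploration V E → ℝ) (l : List E)
    (st : Exploration V E) : ∃ C, ∀ ω : Set E, ‖f (run G p F ω st l)‖ ≤ C := by
  induction l generalizing st with
  | nil => exact ⟨‖f st‖, fun _ => le_rfl⟩
  | cons a l ih =>
    obtain ⟨C₀, h₀⟩ := ih st
    obtain ⟨C₁, h₁⟩ := ih (st.examineOpen G p F a)
    obtain ⟨C₂, h₂⟩ := ih (st.examineClosed p F a)
    refine ⟨max C₀ (max C₁ C₂), fun ω => ?_⟩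
    change ‖f (run G p F ω (step G p F ω st a) l)‖ ≤ _
    rw [step]
    split_ifs
    · exact (h₁ ω).trans ((le_max_left _ _).trans (le_max_right _ _))
    · exact (h₂ ω).trans ((le_max_right _ _).trans (le_max_right _ _))
    · exact (h₀ ω).trans (le_max_left _ _)

theorem integrable_run (p : E → I) (F : E → ℝ) (f : Exploration V E → ℝ) (l : List E)
    (st : Exploration V E) : Integrable (fun ω => f (run G p F ω st l)) (quenchedLaw p) := by
  obtain ⟨C, hC⟩ := exists_norm_run_le (G := G) p F f l st
  exact Integrable.of_bound (measurable_run p F f l st).aestronglyMeasurable C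
    (Filter.Eventually.of_forall hC)

/-- A function of the stage that does not increase on average in any single examination does not
increase on average over a whole exploration. -/
theorem integral_run_le {p : E → I} {F : E → ℝ} {Ψ : Exploration V E → ℝ}
    (hΨ : ∀ st e, st.Admissible G e →
      p e * Ψ (st.examineOpen G p F e) + (1 - p e) * Ψ (st.examineClosed p F e) ≤ Ψ st)
    (l : List E) (st : Exploration V E) :
    ∫ ω, Ψ (run G p F ω st l) ∂(quenchedLaw p) ≤ Ψ st := by
  classical
  induction l generalizing st with
  | nil => simp [run]
  | cons a l ih =>
    by_cases hadm : st.Admissible G a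
    · have h1 : ∀ ω : Set E, Ψ (run G p F (insert a ω) st (a :: l)) =
          Ψ (run G p F ω (st.examineOpen G p F a) l) := by
        intro ω
        change Ψ (run G p F _ (step G p F _ st a) l) = _
        rw [step, if_pos hadm, if_pos (Set.mem_insert _ _)]
        rw [run_congr (ω' := ω) (fun b hb => by simp [hb]) l _ (Finset.mem_insert_self a _)]
      have h2 : ∀ ω : Set E, Ψ (run G p F (ω \ {a}) st (a :: l)) =
          Ψ (run G p F ω (st.examineClosed p F a) l) := by
        intro ω
        change Ψ (run G p F _ (step G p F _ st a) l) = _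
        rw [step, if_pos hadm, if_neg (by simp)]
        rw [run_congr (ω' := ω) (fun b hb => by simp [hb]) l _ (Finset.mem_insert_self a _)]
      have heq := integral_quenchedLaw_resample p a
        (measurable_run (G := G) p F Ψ (a :: l) st)
        (by simp_rw [h1]; exact integrable_run _ _ _ _ _)
        (by simp_rw [h2]; exact integrable_run _ _ _ _ _)
      refine heq.trans_le (le_trans ?_ (hΨ st a hadm))
      simp_rw [h1, h2]
      exact add_le_add (mul_le_mul_of_nonneg_left (ih _) (p a).2.1)
        (mul_le_mul_of_nonneg_left (ih _) (sub_nonneg.2 (p a).2.2))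
    · have : ∀ ω : Set E, run G p F ω st (a :: l) = run G p F ω st l := by
        intro ω
        change run G p F ω (step G p F ω st a) l = _
        rw [step, if_neg hadm]
      simp_rw [this]
      exact ih st

/-! ### The weighted second moment of the exploration martingale -/

open Classical in
/-- The total variance of the unexamined edges touching the vertices found so far, where `D v` is
the set of edges at `v` on which `F` does not vanish. -/
noncomputable def residual (D : V → Finset E) (F : E → ℝ) (L : Finset V) (S : Finset E) : ℝ :=
  ∑ e ∈ L.biUnion D \ S, F e ^ 2

theorem residual_nonneg (D : V → Finset E) (F : E → ℝ) (L : Finset V) (S : Finset E) :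
    0 ≤ residual D F L S := Finset.sum_nonneg fun _ _ => sq_nonneg _

open Classical in
theorem residual_insert_examined {D : V → Finset E} {F : E → ℝ}
    (hD : ∀ v e, e ∈ D v ↔ v ∈ G.ends e ∧ F e ≠ 0) {L : Finset V} {S : Finset E} {e : E}
    (he : e ∉ S) (hL : ∃ u ∈ L, u ∈ G.ends e) :
    residual D F L (insert e S) = residual D F L S - F e ^ 2 := by
  obtain ⟨u, hu, hue⟩ := hL
  have hset : L.biUnion D \ insert e S = (L.biUnion D \ S).erase e := by
    rw [Finset.sdiff_insert]
  rw [residual, residual, hset]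
  by_cases h0 : F e = 0
  · have : e ∉ L.biUnion D \ S := by
      simp only [Finset.mem_sdiff, Finset.mem_biUnion, not_and]
      rintro ⟨v, -, hv⟩
      exact absurd h0 ((hD v e).1 hv).2
    rw [Finset.erase_eq_of_notMem this, h0]
    simp
  · have : e ∈ L.biUnion D \ S :=
      Finset.mem_sdiff.2 ⟨Finset.mem_biUnion.2 ⟨u, hu, (hD u e).2 ⟨hue, h0⟩⟩, he⟩
    rw [← Finset.sum_erase_add _ _ this]
    ring

open Classical in
theorem residual_insert_found {D : V → Finset E} {F : E → ℝ} {B : ℝ}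
    (hB : ∀ v, ∑ e ∈ D v, F e ^ 2 ≤ B) (L : Finset V) (S : Finset E) (v : V) :
    residual D F (insert v L) S ≤ residual D F L S + B := by
  rw [residual, residual, Finset.biUnion_insert, Finset.union_sdiff_distrib]
  calc ∑ e ∈ D v \ S ∪ L.biUnion D \ S, F e ^ 2
      ≤ ∑ e ∈ D v \ S, F e ^ 2 + ∑ e ∈ L.biUnion D \ S, F e ^ 2 := by
        rw [← Finset.sum_union_inter]
        exact le_add_of_nonneg_right (Finset.sum_nonneg fun _ _ => sq_nonneg _)
    _ ≤ B + ∑ e ∈ L.biUnion D \ S, F e ^ 2 := by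
        gcongr
        exact (Finset.sum_le_sum_of_subset_of_nonneg Finset.sdiff_subset
          fun _ _ _ => sq_nonneg _).trans (hB v)
    _ = _ := add_comm _ _

/-- The supermartingale behind the second moment bound. With `w` decreasing in the number of
vertices found, each new vertex brings unexamined edges of total variance at most `B`, which are
paid for by the last term. -/
noncomputable def potential (D : V → Finset E) (F : E → ℝ) (B : ℝ) (w : ℕ → ℝ)
    (st : Exploration V E) : ℝ :=
  w st.found.card * (st.value ^ 2 + residual D F st.found st.examined)
    - B * ∑ j ∈ Finset.Icc 1 st.found.card, w j

theorem potential_examineOpen_le {D : V → Finset E} {F : E → ℝ} {B : ℝ} {w : ℕ → ℝ}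
    (hD : ∀ v e, e ∈ D v ↔ v ∈ G.ends e ∧ F e ≠ 0) (hB : ∀ v, ∑ e ∈ D v, F e ^ 2 ≤ B)
    (hw : ∀ k, 0 ≤ w k) (hanti : ∀ k, 1 ≤ k → w (k + 1) ≤ w k) (p : E → I)
    {st : Exploration V E} {e : E} (hadm : st.Admissible G e) :
    potential D F B w (st.examineOpen G p F e) ≤
      w st.found.card * ((st.value + openIncr p F e) ^ 2 +
        (residual D F st.found st.examined - F e ^ 2)) -
        B * ∑ j ∈ Finset.Icc 1 st.found.card, w j := by
  classical
  obtain ⟨he, u, hu, hue⟩ := hadm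
  obtain ⟨v, hv⟩ := Sym2.mem_iff_exists.1 hue
  have hL : st.found ∪ (G.ends e).toFinset = insert v st.found := by
    rw [hv]
    ext a
    simp only [Finset.mem_union, Sym2.mem_toFinset, Sym2.mem_iff, Finset.mem_insert]
    constructor
    · rintro (h | rfl | rfl)
      · exact Or.inr h
      · exact Or.inr hu
      · exact Or.inl rfl
    · rintro (rfl | h)
      · exact Or.inr (Or.inr rfl)
      · exact Or.inl h
  have hR := residual_insert_examined hD he ⟨u, hu, hue⟩
  simp only [potential, examineOpen, hL]
  by_cases hvL : v ∈ st.found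
  · rw [Finset.insert_eq_of_mem hvL, hR]
  · have hk : 1 ≤ st.found.card := Finset.card_pos.2 ⟨u, hu⟩
    have hnn := residual_nonneg D F st.found (insert e st.examined)
    rw [Finset.card_insert_of_notMem hvL, Finset.sum_Icc_succ_top (by omega), ← hR]
    have h1 := residual_insert_found hB st.found (insert e st.examined) v
    have h2 := mul_le_mul_of_nonneg_left h1 (hw (st.found.card + 1))
    have h3 := mul_le_mul_of_nonneg_right (hanti _ hk)
      (add_nonneg (sq_nonneg (st.value + openIncr p F e)) hnn)
    linarith

theorem potential_step {D : V → Finset E} {F : E → ℝ} {B : ℝ} {w : ℕ → ℝ}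
    (hD : ∀ v e, e ∈ D v ↔ v ∈ G.ends e ∧ F e ≠ 0) (hB : ∀ v, ∑ e ∈ D v, F e ^ 2 ≤ B)
    (hw : ∀ k, 0 ≤ w k) (hanti : ∀ k, 1 ≤ k → w (k + 1) ≤ w k) (p : E → I)
    (st : Exploration V E) (e : E) (hadm : st.Admissible G e) :
    p e * potential D F B w (st.examineOpen G p F e) +
      (1 - p e) * potential D F B w (st.examineClosed p F e) ≤ potential D F B w st := by
  have h0 : (0 : ℝ) ≤ p e := (p e).2.1
  have ho := mul_le_mul_of_nonneg_left (potential_examineOpen_le hD hB hw hanti p hadm) h0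
  have hR := residual_insert_examined hD hadm.1 hadm.2
  have hmean := (mul_openIncr_eq p F e).trans (mul_closedIncr_eq p F e).symm
  have hvar := mul_le_mul_of_nonneg_left (variance_incr_le p F e) (hw st.found.card)
  have hc : potential D F B w (st.examineClosed p F e) =
      w st.found.card * ((st.value - closedIncr p F e) ^ 2 +
        (residual D F st.found st.examined - F e ^ 2)) -
        B * ∑ j ∈ Finset.Icc 1 st.found.card, w j := by
    simp only [potential, examineClosed, hR]
  rw [hc]
  refine (add_le_add_left ho _).trans ?_
  rw [potential]
  generalize w st.found.card = W at *
  generalize residual D F st.found st.examined = R at *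
  generalize ∑ j ∈ Finset.Icc 1 st.found.card, w j = T at *
  have hm : 2 * W * st.value * (p e * openIncr p F e) =
      2 * W * st.value * ((1 - p e) * closedIncr p F e) := by rw [hmean]
  linear_combination hvar + hm

/-- The exploration starting from the single vertex `o`. -/
def start (o : V) : Exploration V E := ⟨{o}, ∅, 0⟩

/-- The second moment bound for the exploration along a finite list of edges. -/
theorem lintegral_value_sq_le {D : V → Finset E} {F : E → ℝ} {B : ℝ} {w : ℕ → ℝ}
    (hD : ∀ v e, e ∈ D v ↔ v ∈ G.ends e ∧ F e ≠ 0) (hB : ∀ v, ∑ e ∈ D v, F e ^ 2 ≤ B)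
    (hw : ∀ k, 0 ≤ w k) (hanti : ∀ k, 1 ≤ k → w (k + 1) ≤ w k) (p : E → I) (o : V)
    (l : List E) :
    ∫⁻ ω, ENNReal.ofReal (w (run G p F ω (start o) l).found.card *
        (run G p F ω (start o) l).value ^ 2) ∂(quenchedLaw p) ≤
      ENNReal.ofReal B * ∫⁻ ω, ENNReal.ofReal (∑ j ∈ Finset.Icc 1
        (run G p F ω (start o) l).found.card, w j) ∂(quenchedLaw p) := by
  classical
  have hB0 : 0 ≤ B := (Finset.sum_nonneg fun _ _ => sq_nonneg _).trans (hB o)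
  have hsum : ∀ k, 0 ≤ ∑ j ∈ Finset.Icc 1 k, w j := fun k => Finset.sum_nonneg fun j _ => hw j
  have hstart : potential D F B w (start o) ≤ 0 := by
    have : residual D F {o} ∅ ≤ B := by simpa [residual] using hB o
    have h1 := mul_le_mul_of_nonneg_left this (hw 1)
    simp only [potential, start, Finset.card_singleton, Finset.Icc_self, Finset.sum_singleton]
    linarith
  have key := (integral_run_le (potential_step hD hB hw hanti p) l (start o)).trans hstart
  have hsq : Integrable (fun ω => w (run G p F ω (start o) l).found.card *
      (run G p F ω (start o) l).value ^ 2) (quenchedLaw p) :=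
    integrable_run (G := G) p F (fun st => w st.found.card * st.value ^ 2) l (start o)
  have hres : Integrable (fun ω => w (run G p F ω (start o) l).found.card *
      residual D F (run G p F ω (start o) l).found (run G p F ω (start o) l).examined)
      (quenchedLaw p) :=
    integrable_run (G := G) p F
      (fun st => w st.found.card * residual D F st.found st.examined) l (start o)
  have hcard : Integrable (fun ω => B * ∑ j ∈ Finset.Icc 1 (run G p F ω (start o) l).found.card,
      w j) (quenchedLaw p) :=
    integrable_run (G := G) p F (fun st => B * ∑ j ∈ Finset.Icc 1 st.found.card, w j) l (start o)
  simp only [potential, mul_add] at key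
  have hadd := integral_add hsq hres
  have hsub := integral_sub (hsq.add hres) hcard
  simp only [Pi.add_apply] at hsub
  rw [hsub, hadd] at key
  have hres0 : 0 ≤ ∫ ω, w (run G p F ω (start o) l).found.card *
      residual D F (run G p F ω (start o) l).found (run G p F ω (start o) l).examined
      ∂(quenchedLaw p) :=
    integral_nonneg fun ω => mul_nonneg (hw _) (residual_nonneg _ _ _ _)
  rw [← lintegral_const_mul' _ _ ENNReal.ofReal_ne_top]
  simp_rw [← ENNReal.ofReal_mul hB0]
  rw [← ofReal_integral_eq_lintegral_ofReal hsq
      (Filter.Eventually.of_forall fun ω => mul_nonneg (hw _) (sq_nonneg _)),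
    ← ofReal_integral_eq_lintegral_ofReal hcard
      (Filter.Eventually.of_forall fun ω => mul_nonneg hB0 (hsum _))]
  exact ENNReal.ofReal_le_ofReal (by linarith)

end Exploration

/-! ### Exhausting a finite cluster -/

open Classical in
/-- The increment contributed by `e` in the configuration `ω`. -/
noncomputable def incr (p : E → I) (F : E → ℝ) (ω : Set E) (e : E) : ℝ :=
  if e ∈ ω then openIncr p F e else -closedIncr p F e

open Classical in
/-- The sum of the open increments over the open edges touching the cluster of `v`. -/
noncomputable def openSum (G : WeightedGraph V E) (p : E → I) (F : E → ℝ) (ω : Set E) (v : V) :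
    ℝ≥0∞ :=
  ∑' e, if (∃ u ∈ G.cluster ω v, u ∈ G.ends e) ∧ e ∈ ω then ENNReal.ofReal (openIncr p F e) else 0

open Classical in
/-- The sum of the closed increments over the closed edges touching the cluster of `v`. -/
noncomputable def closedSum (G : WeightedGraph V E) (p : E → I) (F : E → ℝ) (ω : Set E) (v : V) :
    ℝ≥0∞ :=
  ∑' e, if (∃ u ∈ G.cluster ω v, u ∈ G.ends e) ∧ e ∉ ω then ENNReal.ofReal (closedIncr p F e)
    else 0

theorem openIncr_nonneg {F : E → ℝ} (hF : ∀ e, 0 ≤ F e) (p : E → I) (e : E) :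
    0 ≤ openIncr p F e := mul_nonneg (hF e) (Real.sqrt_nonneg _)

theorem closedIncr_nonneg {F : E → ℝ} (hF : ∀ e, 0 ≤ F e) (p : E → I) (e : E) :
    0 ≤ closedIncr p F e := mul_nonneg (hF e) (Real.sqrt_nonneg _)

namespace Exploration

/-- The invariants of an exploration of the cluster of `o` in the configuration `ω`. -/
structure IsStage (G : WeightedGraph V E) (p : E → I) (F : E → ℝ) (ω : Set E) (o : V)
    (st : Exploration V E) : Prop where
  mem_found : o ∈ st.found
  found_subset : (st.found : Set V) ⊆ G.cluster ω o
  touches : ∀ e ∈ st.examined, ∃ u ∈ st.found, u ∈ G.ends e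
  ends_subset : ∀ e ∈ st.examined, e ∈ ω → ∀ u ∈ G.ends e, u ∈ st.found
  value_eq : st.value = ∑ e ∈ st.examined, incr p F ω e

theorem isStage_start (p : E → I) (F : E → ℝ) (ω : Set E) (o : V) :
    IsStage G p F ω o (start o) where
  mem_found := Finset.mem_singleton_self o
  found_subset := by simpa [start] using mem_cluster_self ω o
  touches := by simp [start]
  ends_subset := by simp [start]
  value_eq := by simp [start]

theorem found_subset_step (p : E → I) (F : E → ℝ) (ω : Set E) (st : Exploration V E) (e : E) :
    st.found ⊆ (step G p F ω st e).found := by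
  classical
  rw [step]
  split_ifs
  · exact fun a ha => Finset.mem_union_left _ ha
  · exact subset_rfl
  · exact subset_rfl

theorem IsStage.step {p : E → I} {F : E → ℝ} {ω : Set E} {o : V} {st : Exploration V E}
    (h : IsStage G p F ω o st) (e : E) : IsStage G p F ω o (step G p F ω st e) := by
  classical
  rw [Exploration.step]
  split_ifs with hadm he
  · obtain ⟨hnew, u, hu, hue⟩ := hadm
    refine ⟨Finset.mem_union_left _ h.mem_found, ?_, ?_, ?_, ?_⟩
    · intro a ha
      rcases Finset.mem_union.1 (Finset.mem_coe.1 ha) with ha | ha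
      · exact h.found_subset ha
      · obtain ⟨v, hv⟩ := Sym2.mem_iff_exists.1 hue
        rw [Sym2.mem_toFinset, hv, Sym2.mem_iff] at ha
        have hu' := h.found_subset (Finset.mem_coe.2 hu)
        rcases ha with rfl | rfl
        · exact hu'
        · exact SimpleGraph.Reachable.trans hu' (mem_cluster_of_ends he hv)
    · intro a ha
      rcases Finset.mem_insert.1 ha with rfl | ha
      · exact ⟨u, Finset.mem_union_left _ hu, hue⟩
      · obtain ⟨v, hv, hva⟩ := h.touches a ha
        exact ⟨v, Finset.mem_union_left _ hv, hva⟩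
    · intro a ha haω v hv
      rcases Finset.mem_insert.1 ha with rfl | ha
      · exact Finset.mem_union_right _ (Sym2.mem_toFinset.2 hv)
      · exact Finset.mem_union_left _ (h.ends_subset a ha haω v hv)
    · simp only [examineOpen]
      rw [Finset.sum_insert hnew, h.value_eq, incr, if_pos he, add_comm]
  · obtain ⟨hnew, u, hu, hue⟩ := hadm
    refine ⟨h.mem_found, h.found_subset, ?_, ?_, ?_⟩
    · intro a ha
      rcases Finset.mem_insert.1 ha with rfl | ha
      · exact ⟨u, hu, hue⟩
      · exact h.touches a ha
    · intro a ha haω v hv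
      rcases Finset.mem_insert.1 ha with rfl | ha
      · exact absurd haω he
      · exact h.ends_subset a ha haω v hv
    · simp only [examineClosed]
      rw [Finset.sum_insert hnew, h.value_eq, incr, if_neg he]
      ring
  · exact h

theorem mem_examined_step {p : E → I} {F : E → ℝ} {ω : Set E} {st : Exploration V E} {e : E}
    (he : ∃ u ∈ st.found, u ∈ G.ends e) : e ∈ (step G p F ω st e).examined := by
  classical
  rw [step]
  split_ifs with hadm _
  · exact Finset.mem_insert_self _ _
  · exact Finset.mem_insert_self _ _
  · by_contra h
    exact hadm ⟨h, he⟩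

/-- The first `t` terms of an enumeration of the edges in which every edge occurs infinitely
often. -/
noncomputable def schedule (E : Type*) [Encodable E] (t : ℕ) : List E :=
  (List.range t).filterMap fun i => Encodable.decode (Nat.unpair i).1

theorem exists_schedule_succ [Encodable E] (e : E) (t₀ : ℕ) :
    ∃ t ≥ t₀, schedule E (t + 1) = schedule E t ++ [e] := by
  refine ⟨Nat.pair (Encodable.encode e) t₀, Nat.right_le_pair _ _, ?_⟩
  simp [schedule, List.range_succ, List.filterMap_append]

section Limit

variable [Encodable E] (p : E → I) (F : E → ℝ) (ω : Set E) (o : V)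

theorem run_schedule_succ (t : ℕ) :
    run G p F ω (start o) (schedule E (t + 1)) = run G p F ω (start o) (schedule E t) ∨
    ∃ e, run G p F ω (start o) (schedule E (t + 1)) =
      step G p F ω (run G p F ω (start o) (schedule E t)) e := by
  have h : schedule E (t + 1) =
      schedule E t ++ [t].filterMap fun i => Encodable.decode (Nat.unpair i).1 := by
    rw [schedule, List.range_succ, List.filterMap_append, schedule]
  rcases hd : (Encodable.decode (Nat.unpair t).1 : Option E) with _ | e
  · left
    rw [h]
    simp [hd]
  · right
    refine ⟨e, ?_⟩
    rw [h]
    simp [hd, run]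

theorem isStage_run (t : ℕ) : IsStage G p F ω o (run G p F ω (start o) (schedule E t)) := by
  induction t with
  | zero => exact isStage_start p F ω o
  | succ t ih =>
    rcases run_schedule_succ (G := G) p F ω o t with h | ⟨e, h⟩
    · rw [h]; exact ih
    · rw [h]; exact ih.step e

theorem monotone_found :
    Monotone fun t => (run G p F ω (start o) (schedule E t)).found := by
  refine monotone_nat_of_le_succ fun t => ?_
  rcases run_schedule_succ (G := G) p F ω o t with h | ⟨e, h⟩
  · rw [h]
  · rw [h]; exact found_subset_step p F ω _ e

theorem monotone_examined :
    Monotone fun t => (run G p F ω (start o) (schedule E t)).examined := by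
  refine monotone_nat_of_le_succ fun t => ?_
  rcases run_schedule_succ (G := G) p F ω o t with h | ⟨e, h⟩
  · rw [h]
  · rw [h]; exact examined_subset_step p F ω _ e

theorem eventually_mem_examined {t₀ : ℕ} {e : E}
    (he : ∃ u ∈ (run G p F ω (start o) (schedule E t₀)).found, u ∈ G.ends e) :
    ∀ᶠ t in Filter.atTop, e ∈ (run G p F ω (start o) (schedule E t)).examined := by
  obtain ⟨t, ht, hs⟩ := exists_schedule_succ e t₀
  obtain ⟨u, hu, hue⟩ := he
  have hmem : e ∈ (run G p F ω (start o) (schedule E (t + 1))).examined := by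
    rw [hs, run, List.foldl_append]
    exact mem_examined_step ⟨u, monotone_found p F ω o ht hu, hue⟩
  filter_upwards [Filter.eventually_ge_atTop (t + 1)] with t' ht'
  exact monotone_examined p F ω o ht' hmem

/-- The exploration of a finite cluster finds the whole cluster. -/
theorem exists_found_eq_cluster (hfin : (G.cluster ω o).Finite) :
    ∃ t₀, ∀ t ≥ t₀, ((run G p F ω (start o) (schedule E t)).found : Set V) = G.cluster ω o := by
  -- The number of vertices found is bounded, so it attains a maximum and stays constant
  -- from then on.
  obtain ⟨t₀, hmax⟩ : ∃ t₀, ∀ t, (run G p F ω (start o) (schedule E t)).found.card ≤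
      (run G p F ω (start o) (schedule E t₀)).found.card := by
    have hb : BddAbove (Set.range fun t =>
        (run G p F ω (start o) (schedule E t)).found.card) := by
      refine ⟨hfin.toFinset.card, ?_⟩
      rintro _ ⟨t, rfl⟩
      refine Finset.card_le_card fun a ha => ?_
      exact hfin.mem_toFinset.2 ((isStage_run p F ω o t).found_subset ha)
    obtain ⟨t₀, ht₀⟩ := Nat.sSup_mem (Set.range_nonempty _) hb
    exact ⟨t₀, fun t => (le_csSup hb ⟨t, rfl⟩).trans_eq ht₀.symm⟩
  have hst : ∀ t ≥ t₀, (run G p F ω (start o) (schedule E t)).found =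
      (run G p F ω (start o) (schedule E t₀)).found := fun t ht =>
    (Finset.eq_of_subset_of_card_le (monotone_found p F ω o ht) (hmax t)).symm
  refine ⟨t₀, fun t ht => ?_⟩
  rw [hst t ht]
  refine subset_antisymm (isStage_run p F ω o t₀).found_subset ?_
  refine cluster_subset_of_closed (isStage_run p F ω o t₀).mem_found fun e he x y hxy hx => ?_
  have hev := eventually_mem_examined (G := G) p F ω o (t₀ := t₀) (e := e)
    ⟨x, hx, by rw [hxy]; exact Sym2.mem_mk_left x y⟩
  obtain ⟨t', ht', hmem⟩ := ((Filter.eventually_ge_atTop t₀).and hev).exists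
  rw [← hst t' ht']
  exact (isStage_run p F ω o t').ends_subset e hmem he y (by rw [hxy]; exact Sym2.mem_mk_right x y)

open Classical in
/-- After finitely many steps the exploration of a finite cluster has found all its vertices and
collected the increments of all its edges on which `F` does not vanish. -/
theorem eventually_value_eq {D : V → Finset E}
    (hD : ∀ v e, e ∈ D v ↔ v ∈ G.ends e ∧ F e ≠ 0) (hfin : (G.cluster ω o).Finite) :
    ∀ᶠ t in Filter.atTop,
      (run G p F ω (start o) (schedule E t)).found = hfin.toFinset ∧
      (run G p F ω (start o) (schedule E t)).value =
        ∑ e ∈ hfin.toFinset.biUnion D, incr p F ω e := by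
  obtain ⟨t₀, ht₀⟩ := exists_found_eq_cluster (G := G) p F ω o hfin
  have hf : ∀ t ≥ t₀, (run G p F ω (start o) (schedule E t)).found = hfin.toFinset := by
    intro t ht
    ext a
    rw [hfin.mem_toFinset, ← ht₀ t ht, Finset.mem_coe]
  have hall : ∀ᶠ t in Filter.atTop, ∀ e ∈ hfin.toFinset.biUnion D,
      e ∈ (run G p F ω (start o) (schedule E t)).examined := by
    refine (Filter.eventually_all_finset _).2 fun e he => ?_
    obtain ⟨v, hv, hev⟩ := Finset.mem_biUnion.1 he
    refine eventually_mem_examined p F ω o (t₀ := t₀) ⟨v, ?_, ((hD v e).1 hev).1⟩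
    rw [hf t₀ le_rfl]; exact hv
  filter_upwards [Filter.eventually_ge_atTop t₀, hall] with t ht hsub
  refine ⟨hf t ht, ?_⟩
  rw [(isStage_run p F ω o t).value_eq]
  refine (Finset.sum_subset hsub fun e he hne => ?_).symm
  obtain ⟨u, hu, hue⟩ := (isStage_run p F ω o t).touches e he
  have h0 : F e = 0 := by
    by_contra h0
    refine hne (Finset.mem_biUnion.2 ⟨u, ?_, (hD u e).2 ⟨hue, h0⟩⟩)
    rw [← hf t ht]; exact hu
  simp [incr, openIncr, closedIncr, h0]

end Limit

end Exploration

theorem sub_sq_le_ofReal_sq {D : V → Finset E} {F : E → ℝ} (hF : ∀ e, 0 ≤ F e)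
    (hD : ∀ v e, e ∈ D v ↔ v ∈ G.ends e ∧ F e ≠ 0) (p : E → I) (ω : Set E) (o : V)
    (hfin : (G.cluster ω o).Finite) [DecidableEq E] :
    (closedSum G p F ω o - openSum G p F ω o) ^ 2 ≤
      ENNReal.ofReal ((∑ e ∈ hfin.toFinset.biUnion D, incr p F ω e) ^ 2) := by
  classical
  have hmem : ∀ e ∈ hfin.toFinset.biUnion D, ∃ u ∈ G.cluster ω o, u ∈ G.ends e := by
    intro e he
    obtain ⟨v, hv, hev⟩ := Finset.mem_biUnion.1 he
    exact ⟨v, hfin.mem_toFinset.1 hv, ((hD v e).1 hev).1⟩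
  have hzero : ∀ e ∉ hfin.toFinset.biUnion D, (∃ u ∈ G.cluster ω o, u ∈ G.ends e) → F e = 0 := by
    rintro e he ⟨u, hu, hue⟩
    by_contra h0
    exact he (Finset.mem_biUnion.2 ⟨u, hfin.mem_toFinset.2 hu, (hD u e).2 ⟨hue, h0⟩⟩)
  have ho : openSum G p F ω o = ENNReal.ofReal
      (∑ e ∈ hfin.toFinset.biUnion D, if e ∈ ω then openIncr p F e else 0) := by
    rw [openSum, tsum_eq_sum (s := hfin.toFinset.biUnion D), ENNReal.ofReal_sum_of_nonneg]
    · refine Finset.sum_congr rfl fun e he => ?_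
      by_cases h : e ∈ ω <;> simp [h, hmem e he]
    · intro e _
      split_ifs
      exacts [openIncr_nonneg hF p e, le_rfl]
    · intro e he
      split_ifs with h
      · simp [openIncr, hzero e he h.1]
      · rfl
  have hc : closedSum G p F ω o = ENNReal.ofReal
      (∑ e ∈ hfin.toFinset.biUnion D, if e ∈ ω then 0 else closedIncr p F e) := by
    rw [closedSum, tsum_eq_sum (s := hfin.toFinset.biUnion D), ENNReal.ofReal_sum_of_nonneg]
    · refine Finset.sum_congr rfl fun e he => ?_
      by_cases h : e ∈ ω <;> simp [h, hmem e he]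
    · intro e _
      split_ifs
      exacts [le_rfl, closedIncr_nonneg hF p e]
    · intro e he
      split_ifs with h
      · simp [closedIncr, hzero e he h.1]
      · rfl
  rw [ho, hc, ← ENNReal.ofReal_sub _ (Finset.sum_nonneg fun e _ => by
    split_ifs
    exacts [openIncr_nonneg hF p e, le_rfl]), ← Finset.sum_sub_distrib]
  have : ∑ e ∈ hfin.toFinset.biUnion D, ((if e ∈ ω then 0 else closedIncr p F e) -
      if e ∈ ω then openIncr p F e else 0) = -∑ e ∈ hfin.toFinset.biUnion D, incr p F ω e := by
    rw [← Finset.sum_neg_distrib]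
    refine Finset.sum_congr rfl fun e _ => ?_
    rw [incr]
    split_ifs <;> ring
  rw [this]
  generalize ∑ e ∈ hfin.toFinset.biUnion D, incr p F ω e = z
  rcases le_total z 0 with hz | hz
  · rw [← ENNReal.ofReal_pow (by linarith), neg_sq]
  · rw [ENNReal.ofReal_of_nonpos (by linarith)]
    simp

theorem sum_Icc_one_eq_sum_range {M : Type*} [AddCommMonoid M] (f : ℕ → M) (k : ℕ) :
    ∑ j ∈ Finset.Icc 1 k, f j = ∑ j ∈ Finset.range k, f (j + 1) := by
  induction k with
  | zero => simp
  | succ k ih => rw [Finset.sum_Icc_succ_top (by omega), Finset.sum_range_succ, ih]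

/-- The weighted second moment bound for the discrepancy between the closed and the open edges
touching a finite cluster. -/
theorem lintegral_sub_sq_le [Countable V] [Countable E] {D : V → Finset E} {F : E → ℝ} {B : ℝ}
    {w : ℕ → ℝ} (hF : ∀ e, 0 ≤ F e) (hD : ∀ v e, e ∈ D v ↔ v ∈ G.ends e ∧ F e ≠ 0)
    (hB : ∀ v, ∑ e ∈ D v, F e ^ 2 ≤ B)
    (hw : ∀ k, 0 ≤ w k) (hanti : ∀ k, 1 ≤ k → w (k + 1) ≤ w k) (p : E → I) (o : V) :
    ∫⁻ ω, {ω | (G.cluster ω o).Finite}.indicator (fun ω =>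
        ENNReal.ofReal (w (G.cluster ω o).ncard) *
          (closedSum G p F ω o - openSum G p F ω o) ^ 2) ω ∂(quenchedLaw p) ≤
      ENNReal.ofReal B * ∑' j : ℕ, ENNReal.ofReal (w (j + 1)) *
        quenchedLaw p {ω | ((j + 1 : ℕ) : ℕ∞) ≤ (G.cluster ω o).encard} := by
  classical
  have : Encodable E := Encodable.ofCountable E
  set f : ℕ → Set E → ℝ≥0∞ := fun t ω => ENNReal.ofReal
    (w (Exploration.run G p F ω (Exploration.start o) (Exploration.schedule E t)).found.card *
      (Exploration.run G p F ω (Exploration.start o) (Exploration.schedule E t)).value ^ 2) with hf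
  have hfm : ∀ t, Measurable (f t) := fun t => Exploration.measurable_run (G := G) p F
    (fun st => ENNReal.ofReal (w st.found.card * st.value ^ 2)) _ _
  have hbound : ∀ t, ∫⁻ ω, f t ω ∂(quenchedLaw p) ≤
      ENNReal.ofReal B * ∑' j : ℕ, ENNReal.ofReal (w (j + 1)) *
        quenchedLaw p {ω | ((j + 1 : ℕ) : ℕ∞) ≤ (G.cluster ω o).encard} := by
    intro t
    refine (Exploration.lintegral_value_sq_le hD hB hw hanti p o _).trans ?_
    gcongr
    have hms : ∀ j : ℕ, MeasurableSet {ω : Set E | ((j + 1 : ℕ) : ℕ∞) ≤ (G.cluster ω o).encard} :=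
      fun j => measurableSet_le_encard_cluster _ _
    calc ∫⁻ ω, ENNReal.ofReal (∑ j ∈ Finset.Icc 1 (Exploration.run G p F ω (Exploration.start o)
          (Exploration.schedule E t)).found.card, w j) ∂(quenchedLaw p)
        ≤ ∫⁻ ω, ∑' j : ℕ, ENNReal.ofReal (w (j + 1)) *
          {ω : Set E | ((j + 1 : ℕ) : ℕ∞) ≤ (G.cluster ω o).encard}.indicator 1 ω
            ∂(quenchedLaw p) := by
          refine lintegral_mono fun ω => ?_
          set L := (Exploration.run G p F ω (Exploration.start o)
            (Exploration.schedule E t)).found with hL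
          have hsub : (L : Set V) ⊆ G.cluster ω o :=
            (Exploration.isStage_run p F ω o t).found_subset
          have hcard : (L.card : ℕ∞) ≤ (G.cluster ω o).encard := by
            rw [← Set.encard_coe_eq_coe_finsetCard]
            exact Set.encard_le_encard hsub
          rw [ENNReal.ofReal_sum_of_nonneg fun j _ => hw j, sum_Icc_one_eq_sum_range]
          refine le_trans (Finset.sum_le_sum fun j hj => ?_) (ENNReal.sum_le_tsum
            (Finset.range L.card))
          have hj' : ((j + 1 : ℕ) : ℕ∞) ≤ (G.cluster ω o).encard :=
            le_trans (Nat.cast_le.2 (Finset.mem_range.1 hj)) hcard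
          rw [Set.indicator_of_mem (by exact hj'), Pi.one_apply, mul_one]
      _ = _ := by
          rw [lintegral_tsum fun j =>
            ((measurable_one.indicator (hms j)).const_mul _).aemeasurable]
          refine tsum_congr fun j => ?_
          rw [lintegral_const_mul _ (measurable_one.indicator (hms j)),
            lintegral_indicator_one (hms j)]
  calc _ ≤ ∫⁻ ω, Filter.liminf (fun t => f t ω) Filter.atTop ∂(quenchedLaw p) := by
        refine lintegral_mono fun ω => ?_
        by_cases hfin : (G.cluster ω o).Finite
        · rw [Set.indicator_of_mem (by exact hfin)]
          refine Filter.le_liminf_of_le (by isBoundedDefault) ?_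
          filter_upwards [Exploration.eventually_value_eq (G := G) p F ω o hD hfin] with t ht
          rw [hf]
          simp only
          rw [ht.1, ht.2, ENNReal.ofReal_mul (hw _), Set.ncard_eq_toFinset_card _ hfin]
          gcongr
          exact sub_sq_le_ofReal_sq hF hD p ω o hfin
        · rw [Set.indicator_of_notMem (by exact hfin)]
          exact zero_le
    _ ≤ Filter.liminf (fun t => ∫⁻ ω, f t ω ∂(quenchedLaw p)) Filter.atTop :=
        lintegral_liminf_le hfm
    _ ≤ _ := Filter.liminf_le_of_frequently_le' (Filter.Frequently.of_forall hbound)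

/-! ### Automorphisms and invariance -/

theorem Aut.ends_edge (γ : G.Aut) (e : E) :
    G.ends (Aut.edge γ e) = (G.ends e).map (Aut.vert γ) := (γ.2 e).1

theorem Aut.J_edge (γ : G.Aut) (e : E) : G.J (Aut.edge γ e) = G.J e := (γ.2 e).2

theorem Aut.mem_ends_edge (γ : G.Aut) (e : E) (v : V) :
    Aut.vert γ v ∈ G.ends (Aut.edge γ e) ↔ v ∈ G.ends e := by
  rw [Aut.ends_edge, Sym2.mem_map]
  exact ⟨fun ⟨u, hu, h⟩ => (Aut.vert γ).injective h ▸ hu, fun h => ⟨v, h, rfl⟩⟩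

/-- The image of a configuration of open edges under an automorphism. -/
def Aut.mapConfig (γ : G.Aut) (ω : Set E) : Set E := (Aut.edge γ).symm ⁻¹' ω

theorem Aut.edge_mem_mapConfig (γ : G.Aut) (ω : Set E) (e : E) :
    Aut.edge γ e ∈ Aut.mapConfig γ ω ↔ e ∈ ω := by
  simp [Aut.mapConfig]

theorem Aut.mapConfig_inv_mapConfig (γ : G.Aut) (ω : Set E) :
    Aut.mapConfig γ⁻¹ (Aut.mapConfig γ ω) = ω := by
  ext e
  change (Aut.edge γ).symm ((Aut.edge γ) e) ∈ ω ↔ e ∈ ω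
  rw [Equiv.symm_apply_apply]

theorem Aut.vert_inv_vert (γ : G.Aut) (v : V) : Aut.vert γ⁻¹ (Aut.vert γ v) = v :=
  Equiv.symm_apply_apply (Aut.vert γ) v

theorem Aut.edge_inv_edge (γ : G.Aut) (e : E) : Aut.edge γ⁻¹ (Aut.edge γ e) = e :=
  Equiv.symm_apply_apply (Aut.edge γ) e

theorem mem_cluster_mapConfig_of_mem (γ : G.Aut) {ω : Set E} {u v : V}
    (h : u ∈ G.cluster ω v) :
    Aut.vert γ u ∈ G.cluster (Aut.mapConfig γ ω) (Aut.vert γ v) := by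
  refine cluster_subset_of_closed
    (C := {u | Aut.vert γ u ∈ G.cluster (Aut.mapConfig γ ω) (Aut.vert γ v)})
    (mem_cluster_self _ _) ?_ h
  intro e he x y hxy hx
  refine SimpleGraph.Reachable.trans hx
    (mem_cluster_of_ends ((Aut.edge_mem_mapConfig γ ω e).2 he) ?_)
  rw [Aut.ends_edge, hxy, Sym2.map_mk]

theorem mem_cluster_mapConfig (γ : G.Aut) {ω : Set E} {u v : V} :
    Aut.vert γ u ∈ G.cluster (Aut.mapConfig γ ω) (Aut.vert γ v) ↔ u ∈ G.cluster ω v := by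
  refine ⟨fun h => ?_, mem_cluster_mapConfig_of_mem γ⟩
  have := mem_cluster_mapConfig_of_mem γ⁻¹ h
  rwa [Aut.mapConfig_inv_mapConfig, Aut.vert_inv_vert, Aut.vert_inv_vert] at this

theorem cluster_mapConfig (γ : G.Aut) (ω : Set E) (v : V) :
    G.cluster (Aut.mapConfig γ ω) (Aut.vert γ v) = Aut.vert γ '' G.cluster ω v := by
  ext u
  obtain ⟨u, rfl⟩ := (Aut.vert γ).surjective u
  rw [mem_cluster_mapConfig, (Aut.vert γ).injective.mem_set_image]

theorem encard_cluster_mapConfig (γ : G.Aut) (ω : Set E) (v : V) :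
    (G.cluster (Aut.mapConfig γ ω) (Aut.vert γ v)).encard = (G.cluster ω v).encard := by
  rw [cluster_mapConfig, (Aut.vert γ).injective.encard_image]

theorem touches_mapConfig (γ : G.Aut) (ω : Set E) (v : V) (e : E) :
    (∃ u ∈ G.cluster (Aut.mapConfig γ ω) (Aut.vert γ v), u ∈ G.ends (Aut.edge γ e)) ↔
      ∃ u ∈ G.cluster ω v, u ∈ G.ends e := by
  constructor
  · rintro ⟨u, hu, hue⟩
    obtain ⟨u, rfl⟩ := (Aut.vert γ).surjective u
    exact ⟨u, (mem_cluster_mapConfig γ).1 hu, (Aut.mem_ends_edge γ e u).1 hue⟩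
  · rintro ⟨u, hu, hue⟩
    exact ⟨_, (mem_cluster_mapConfig γ).2 hu, (Aut.mem_ends_edge γ e u).2 hue⟩

theorem TwoArm.mapConfig (γ : G.Aut) {e : E} {n : ℕ} {ω : Set E} (h : G.TwoArm e n ω) :
    G.TwoArm (Aut.edge γ e) n (Aut.mapConfig γ ω) := by
  obtain ⟨x, y, hxy, hne, hx, hy, hfin⟩ := h
  refine ⟨Aut.vert γ x, Aut.vert γ y, ?_, ?_, ?_, ?_, ?_⟩
  · rw [Aut.ends_edge, hxy, Sym2.map_mk]
  · rw [cluster_ne_iff] at hne ⊢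
    rwa [mem_cluster_mapConfig]
  · rwa [encard_cluster_mapConfig]
  · rwa [encard_cluster_mapConfig]
  · rw [cluster_mapConfig, cluster_mapConfig]
    exact hfin.imp (fun h => h.image _) (fun h => h.image _)

theorem twoArm_mapConfig (γ : G.Aut) {e : E} {n : ℕ} {ω : Set E} :
    G.TwoArm (Aut.edge γ e) n (Aut.mapConfig γ ω) ↔ G.TwoArm e n ω := by
  refine ⟨fun h => ?_, TwoArm.mapConfig γ⟩
  have := TwoArm.mapConfig γ⁻¹ h
  rwa [Aut.mapConfig_inv_mapConfig, Aut.edge_inv_edge] at this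

/-- The action of an automorphism on pairs consisting of an environment and a configuration. -/
def Aut.mapPair (γ : G.Aut) (x : (E → I) × Set E) : (E → I) × Set E :=
  (fun e => x.1 ((Aut.edge γ).symm e), Aut.mapConfig γ x.2)

theorem Aut.mapPair_fst_edge (γ : G.Aut) (x : (E → I) × Set E) (e : E) :
    (Aut.mapPair γ x).1 (Aut.edge γ e) = x.1 e := by
  simp [Aut.mapPair]

theorem Aut.measurable_mapPair (γ : G.Aut) : Measurable (Aut.mapPair γ) := by
  refine Measurable.prodMk ?_ ?_
  · exact measurable_pi_iff.2 fun e => (measurable_pi_apply _).comp measurable_fst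
  · exact measurable_set_iff.2 fun e => (measurable_set_mem ((Aut.edge γ).symm e)).comp
      measurable_snd

theorem map_perm_labelLaw (π : Equiv.Perm E) :
    (labelLaw E).map (fun U e => U (π.symm e)) = labelLaw E := by
  have h := Measure.infinitePi_map_piCongrLeft (fun _ : E => (volume : Measure I)) π
  have hfun : (fun (U : E → I) e => U (π.symm e)) =
      MeasurableEquiv.piCongrLeft (fun _ : E => I) π := by
    funext U e
    obtain ⟨e, rfl⟩ := π.surjective e
    rw [MeasurableEquiv.piCongrLeft_apply_apply, Equiv.symm_apply_apply]
  rw [hfun]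
  exact h

/-- The joint law of environment and configuration inherits the invariance of the environment. -/
theorem measurePreserving_mapPair {Γ : Subgroup G.Aut} {μ : Measure (E → I)}
    [IsProbabilityMeasure μ] (hinv : IsInvariantEnv Γ μ) {γ : G.Aut} (hγ : γ ∈ Γ) :
    MeasurePreserving (Aut.mapPair γ) (percLaw μ) (percLaw μ) := by
  refine ⟨Aut.measurable_mapPair γ, ?_⟩
  have hm : Measurable fun (p : E → I) e => p ((Aut.edge γ).symm e) :=
    measurable_pi_iff.2 fun e => measurable_pi_apply _
  have hprod := Measure.map_prod_map μ (labelLaw E) hm hm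
  rw [hinv γ hγ, map_perm_labelLaw] at hprod
  rw [percLaw, Measure.map_map (Aut.measurable_mapPair γ) measurable_openEdges]
  conv_rhs => rw [hprod]
  rw [Measure.map_map measurable_openEdges (hm.prodMap hm)]
  rfl

theorem lintegral_percLaw {μ : Measure (E → I)} [IsProbabilityMeasure μ]
    {h : (E → I) × Set E → ℝ≥0∞} (hh : Measurable h) :
    ∫⁻ x, h x ∂(percLaw μ) = ∫⁻ p, ∫⁻ ω, h (p, ω) ∂(quenchedLaw p) ∂μ := by
  rw [percLaw, lintegral_map hh measurable_openEdges,
    lintegral_prod (fun x : (E → I) × (E → I) => h (x.1, openEdges x.1 x.2))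
      (hh.comp measurable_openEdges).aemeasurable]
  refine lintegral_congr fun p => ?_
  rw [quenchedLaw, lintegral_map (f := fun ω => h (p, ω)) (hh.comp measurable_prodMk_left)
    (measurable_openEdges_right p)]

/-! ### Mass transport -/

/-- The orbit of a pair of vertices under the diagonal action. -/
def pairOrbit (Γ : Subgroup G.Aut) (a b : V) : Set (V × V) :=
  {q | ∃ γ ∈ Γ, Aut.vert γ a = q.1 ∧ Aut.vert γ b = q.2}

theorem mem_pairOrbit_self (Γ : Subgroup G.Aut) (a b : V) : (a, b) ∈ pairOrbit Γ a b :=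
  ⟨1, Γ.one_mem, rfl, rfl⟩

theorem pairOrbit_eq_of_mem {Γ : Subgroup G.Aut} {a b c d : V} (h : (c, d) ∈ pairOrbit Γ a b) :
    pairOrbit Γ c d = pairOrbit Γ a b := by
  obtain ⟨γ, hγ, rfl, rfl⟩ := h
  ext ⟨x, y⟩
  constructor
  · rintro ⟨δ, hδ, h1, h2⟩
    exact ⟨δ * γ, Γ.mul_mem hδ hγ, h1, h2⟩
  · rintro ⟨δ, hδ, h1, h2⟩
    refine ⟨δ * γ⁻¹, Γ.mul_mem hδ (Γ.inv_mem hγ), ?_, ?_⟩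
    · change Aut.vert δ (Aut.vert γ⁻¹ (Aut.vert γ a)) = _
      rw [Aut.vert_inv_vert]; exact h1
    · change Aut.vert δ (Aut.vert γ⁻¹ (Aut.vert γ b)) = _
      rw [Aut.vert_inv_vert]; exact h2

theorem stabOrbit_map {Γ : Subgroup G.Aut} {γ : G.Aut} (hγ : γ ∈ Γ) (x y : V) :
    stabOrbit Γ (Aut.vert γ x) (Aut.vert γ y) = Aut.vert γ '' stabOrbit Γ x y := by
  ext z
  constructor
  · rintro ⟨δ, hδ, h1, rfl⟩
    refine ⟨Aut.vert γ⁻¹ (Aut.vert δ (Aut.vert γ y)), ⟨γ⁻¹ * δ * γ,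
      Γ.mul_mem (Γ.mul_mem (Γ.inv_mem hγ) hδ) hγ, ?_, rfl⟩,
      Equiv.apply_symm_apply (Aut.vert γ) _⟩
    change Aut.vert γ⁻¹ (Aut.vert δ (Aut.vert γ x)) = x
    rw [h1, Aut.vert_inv_vert]
  · rintro ⟨_, ⟨δ, hδ, h1, rfl⟩, rfl⟩
    refine ⟨γ * δ * γ⁻¹, Γ.mul_mem (Γ.mul_mem hγ hδ) (Γ.inv_mem hγ), ?_, ?_⟩
    · change Aut.vert γ (Aut.vert δ (Aut.vert γ⁻¹ (Aut.vert γ x))) = _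
      rw [Aut.vert_inv_vert, h1]
    · change Aut.vert γ (Aut.vert δ (Aut.vert γ⁻¹ (Aut.vert γ y))) = _
      rw [Aut.vert_inv_vert]

/-- The mass transport principle. Mass sent within a single diagonal orbit is received in the same
amount because the two stabilizer orbits have the same size. -/
theorem tsum_transport {Γ : Subgroup G.Aut} (htrans : IsTransitive Γ) (hunim : IsUnimodular Γ)
    {T : V → V → ℝ≥0∞}
    (hT : ∀ γ ∈ Γ, ∀ u v, T (Aut.vert γ u) (Aut.vert γ v) = T u v) (o : V) :
    ∑' u, T o u = ∑' v, T v o := by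
  rw [← ENNReal.tsum_fiberwise (fun u => T o u) (fun u => pairOrbit Γ o u),
    ← ENNReal.tsum_fiberwise (fun v => T v o) (fun v => pairOrbit Γ v o)]
  refine tsum_congr fun q => ?_
  by_cases hq : ∃ x, pairOrbit Γ o x = q
  · obtain ⟨x, rfl⟩ := hq
    obtain ⟨γ, hγ, hγx⟩ := htrans x o
    have h1 : (fun u => pairOrbit Γ o u) ⁻¹' {pairOrbit Γ o x} = stabOrbit Γ o x := by
      ext u
      refine ⟨fun h => ?_, fun h => pairOrbit_eq_of_mem h⟩
      have hm : (o, u) ∈ pairOrbit Γ o x :=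
        (show pairOrbit Γ o u = pairOrbit Γ o x from h) ▸ mem_pairOrbit_self Γ o u
      exact hm
    have hyo : pairOrbit Γ (Aut.vert γ o) o = pairOrbit Γ o x :=
      pairOrbit_eq_of_mem ⟨γ, hγ, rfl, hγx⟩
    have h2 : (fun v => pairOrbit Γ v o) ⁻¹' {pairOrbit Γ o x} =
        stabOrbit Γ o (Aut.vert γ o) := by
      ext v
      rw [← hyo]
      constructor
      · intro h
        have hm : (v, o) ∈ pairOrbit Γ (Aut.vert γ o) o :=
          (show pairOrbit Γ v o = pairOrbit Γ (Aut.vert γ o) o from h) ▸ mem_pairOrbit_self Γ v o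
        obtain ⟨δ, hδ, h1, h2⟩ := hm
        exact ⟨δ, hδ, h2, h1⟩
      · rintro ⟨δ, hδ, h1, h2⟩
        exact pairOrbit_eq_of_mem ⟨δ, hδ, h2, h1⟩
    have hcard : (stabOrbit Γ o x).encard = (stabOrbit Γ o (Aut.vert γ o)).encard := by
      rw [hunim o (Aut.vert γ o)]
      conv_rhs => rw [← hγx]
      rw [stabOrbit_map hγ, (Aut.vert γ).injective.encard_image, hγx]
    have hv1 : ∀ u : stabOrbit Γ o x, T o u = T o x := by
      rintro ⟨_, δ, hδ, h1, rfl⟩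
      have h := hT δ hδ o x
      rwa [h1] at h
    have hv2 : ∀ v : stabOrbit Γ o (Aut.vert γ o), T v o = T o x := by
      rintro ⟨_, δ, hδ, h1, rfl⟩
      have h := (hT δ hδ _ o).trans ((congrArg _ hγx.symm).trans (hT γ hγ o x))
      rwa [h1] at h
    rw [h1, h2, tsum_congr hv1, tsum_congr hv2, ENNReal.tsum_set_const, ENNReal.tsum_set_const,
      hcard]
  · have h1 : (fun u => pairOrbit Γ o u) ⁻¹' {q} = ∅ :=
      Set.eq_empty_of_forall_notMem fun u hu => hq ⟨u, hu⟩
    have h2 : (fun v => pairOrbit Γ v o) ⁻¹' {q} = ∅ := by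
      refine Set.eq_empty_of_forall_notMem fun v hv => ?_
      obtain ⟨γ, hγ, hγv⟩ := htrans v o
      refine hq ⟨Aut.vert γ o, ?_⟩
      rw [← show pairOrbit Γ v o = q from hv]
      exact pairOrbit_eq_of_mem ⟨γ, hγ, hγv, rfl⟩
    rw [h1, h2, tsum_empty, tsum_empty]

theorem tsum_mem_ends {e : E} (he : ¬ (G.ends e).IsDiag) (c : ℝ≥0∞)
    [DecidablePred (· ∈ G.ends e)] : ∑' u, (if u ∈ G.ends e then c else 0) = 2 * c := by
  classical
  obtain ⟨x, y, hxy⟩ : ∃ x y, G.ends e = s(x, y) := by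
    induction h : G.ends e with
    | h x y => exact ⟨x, y, rfl⟩
  have hne : x ≠ y := by rwa [hxy, Sym2.mk_isDiag_iff] at he
  rw [tsum_eq_sum (s := {x, y}), Finset.sum_pair hne, if_pos (by simp [hxy]),
    if_pos (by simp [hxy]), two_mul]
  intro u hu
  refine if_neg ?_
  rw [hxy, Sym2.mem_iff]
  simpa using hu

open Classical in
/-- Every vertex distributes the weighted sum of `X` over the edges touching its cluster equally
among the endpoints of these edges. -/
theorem two_mul_lintegral_sizeWeight_mul [Countable V] [Countable E] {Γ : Subgroup G.Aut}
    (htrans : IsTransitive Γ) (hunim : IsUnimodular Γ) {μ : Measure (E → I)}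
    [IsProbabilityMeasure μ] (hinv : IsInvariantEnv Γ μ)
    {X : (E → I) × Set E → E → ℝ≥0∞} (hX : ∀ e, Measurable fun x => X x e)
    (hXinv : ∀ γ ∈ Γ, ∀ x e, X (Aut.mapPair γ x) (Aut.edge γ e) = X x e)
    (hdiag : ∀ x e, (G.ends e).IsDiag → X x e = 0) (n : ℕ) (o : V) :
    2 * ∫⁻ x, sizeWeight n (G.cluster x.2 o).encard *
        ∑' e, (if ∃ u ∈ G.cluster x.2 o, u ∈ G.ends e then X x e else 0) ∂(percLaw μ) =
      ∑' e : G.edgesAt o, ∫⁻ x, X x e * edgeMass G n x.2 e ∂(percLaw μ) := by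
  set c : V → E → (E → I) × Set E → ℝ≥0∞ := fun v e x =>
    if ∃ u ∈ G.cluster x.2 v, u ∈ G.ends e then sizeWeight n (G.cluster x.2 v).encard * X x e
    else 0 with hc
  have hcm : ∀ v e, Measurable (c v e) := fun v e =>
    Measurable.ite (measurable_snd (measurableSet_touches e v))
      (((measurable_sizeWeight_cluster n v).comp measurable_snd).mul (hX e)) measurable_const
  have hcinv : ∀ γ ∈ Γ, ∀ v e x, c (Aut.vert γ v) (Aut.edge γ e) (Aut.mapPair γ x) = c v e x := by
    intro γ hγ v e x
    simp only [hc, hXinv γ hγ]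
    simp only [Aut.mapPair, touches_mapConfig, encard_cluster_mapConfig]
  set g : V → V → E → (E → I) × Set E → ℝ≥0∞ := fun v u e x =>
    if u ∈ G.ends e then c v e x else 0 with hg
  have hgm : ∀ v u e, Measurable (g v u e) := fun v u e =>
    Measurable.ite (MeasurableSet.const _) (hcm v e) measurable_const
  set T : V → V → ℝ≥0∞ := fun v u => ∫⁻ x, ∑' e, g v u e x ∂(percLaw μ) with hTdef
  have hT : ∀ γ ∈ Γ, ∀ v u, T (Aut.vert γ v) (Aut.vert γ u) = T v u := by
    intro γ hγ v u
    simp only [hTdef]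
    rw [← (measurePreserving_mapPair hinv hγ).lintegral_comp
      (Measurable.tsum fun e => hgm (Aut.vert γ v) (Aut.vert γ u) e)]
    refine lintegral_congr fun x => ?_
    rw [← (Aut.edge γ).tsum_eq]
    refine tsum_congr fun e => ?_
    simp only [hg, hcinv γ hγ, Aut.mem_ends_edge]
  have key := tsum_transport htrans hunim hT o
  have hleft : ∑' u, T o u = 2 * ∫⁻ x, sizeWeight n (G.cluster x.2 o).encard *
        ∑' e, (if ∃ u ∈ G.cluster x.2 o, u ∈ G.ends e then X x e else 0) ∂(percLaw μ) := by
    rw [← lintegral_const_mul' _ _ (by simp), ← lintegral_tsum fun u =>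
      (Measurable.tsum fun e => hgm o u e).aemeasurable]
    refine lintegral_congr fun x => ?_
    rw [ENNReal.tsum_comm, ← ENNReal.tsum_mul_left, ← ENNReal.tsum_mul_left]
    refine tsum_congr fun e => ?_
    by_cases hd : (G.ends e).IsDiag
    · simp [hg, hc, hdiag x e hd]
    · simp only [hg]
      rw [tsum_mem_ends hd]
      simp only [hc]
      split_ifs <;> simp
  have hright : ∑' v, T v o =
      ∑' e : G.edgesAt o, ∫⁻ x, X x e * edgeMass G n x.2 e ∂(percLaw μ) := by
    rw [tsum_subtype (G.edgesAt o)
      (fun e => ∫⁻ x, X x e * edgeMass G n x.2 e ∂(percLaw μ))]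
    have : ∀ v, T v o = ∑' e, ∫⁻ x, g v o e x ∂(percLaw μ) := fun v =>
      lintegral_tsum fun e => (hgm v o e).aemeasurable
    simp_rw [this]
    rw [ENNReal.tsum_comm]
    refine tsum_congr fun e => ?_
    rw [← lintegral_tsum fun v => (hgm v o e).aemeasurable, Set.indicator_apply]
    split_ifs with h
    · refine lintegral_congr fun x => ?_
      rw [edgeMass, ← ENNReal.tsum_mul_left]
      refine tsum_congr fun v => ?_
      have h' : o ∈ G.ends e := h
      simp only [hg, hc, if_pos h']
      split_ifs
      · rw [mul_comm]
      · simp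
    · have h' : o ∉ G.ends e := h
      simp [hg, h']
  rw [← hleft, ← hright, key]

/-! ### The two-arm event and the discrepancy of clusters -/

open Classical in
/-- The increment of `e` on the event that `e` is open. -/
noncomputable def openPart (F : E → ℝ) (x : (E → I) × Set E) (e : E) : ℝ≥0∞ :=
  if e ∈ x.2 then ENNReal.ofReal (openIncr x.1 F e) else 0

open Classical in
/-- Minus the increment of `e` on the event that `e` is closed. -/
noncomputable def closedPart (F : E → ℝ) (x : (E → I) × Set E) (e : E) : ℝ≥0∞ :=
  if e ∈ x.2 then 0 else ENNReal.ofReal (closedIncr x.1 F e)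

theorem measurableSet_mem_snd (e : E) : MeasurableSet {x : (E → I) × Set E | e ∈ x.2} :=
  measurable_snd (measurableSet_setOfPred.2 (measurable_set_mem e))

theorem measurable_openIncr (F : E → ℝ) (e : E) : Measurable fun p : E → I => openIncr p F e := by
  have : Measurable fun p : E → I => ((p e : I) : ℝ) :=
    measurable_subtype_coe.comp (measurable_pi_apply e)
  unfold openIncr
  fun_prop

theorem measurable_closedIncr (F : E → ℝ) (e : E) :
    Measurable fun p : E → I => closedIncr p F e := by
  have : Measurable fun p : E → I => ((p e : I) : ℝ) :=
    measurable_subtype_coe.comp (measurable_pi_apply e)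
  unfold closedIncr
  fun_prop

theorem measurable_openPart (F : E → ℝ) (e : E) :
    Measurable fun x : (E → I) × Set E => openPart F x e :=
  Measurable.ite (measurableSet_mem_snd e)
    ((measurable_openIncr F e).comp measurable_fst).ennreal_ofReal measurable_const

theorem measurable_closedPart (F : E → ℝ) (e : E) :
    Measurable fun x : (E → I) × Set E => closedPart F x e :=
  Measurable.ite (measurableSet_mem_snd e) measurable_const
    ((measurable_closedIncr F e).comp measurable_fst).ennreal_ofReal

theorem measurable_odds : Measurable odds := by
  unfold odds
  exact (measurable_subtype_coe.ennreal_ofReal).div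
    ((measurable_const.sub measurable_subtype_coe).ennreal_ofReal)

theorem ofReal_mul_odds_rpow (t : I) :
    ENNReal.ofReal (1 - t) * odds t ^ (1 / 2 : ℝ) = ENNReal.ofReal √(t * (1 - t)) := by
  have h0 : (0 : ℝ) ≤ 1 - t := sub_nonneg.2 t.2.2
  rcases h0.eq_or_lt with h | h
  · simp [← h]
  · rw [odds, ← ENNReal.ofReal_div_of_pos h,
      ENNReal.ofReal_rpow_of_nonneg (div_nonneg t.2.1 h0) (by norm_num), ← Real.sqrt_eq_rpow,
      ← ENNReal.ofReal_mul h0]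
    congr 1
    have : (t : ℝ) * (1 - t) = (1 - t : ℝ) ^ 2 * (t / (1 - t)) := by field_simp
    rw [this, Real.sqrt_mul (sq_nonneg _), Real.sqrt_sq h0]

theorem lintegral_openPart_mul (p : E → I) {F : E → ℝ} (e : E)
    {h : Set E → ℝ≥0∞} (hh : Measurable h) :
    ∫⁻ ω, openPart F (p, ω) e * h ω ∂(quenchedLaw p) =
      ENNReal.ofReal (F e * √(p e * (1 - p e))) * ∫⁻ ω, h (insert e ω) ∂(quenchedLaw p) := by
  have hm : Measurable fun ω : Set E => openPart F (p, ω) e * h ω :=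
    ((measurable_openPart F e).comp measurable_prodMk_left).mul hh
  rw [lintegral_quenchedLaw_resample p e hm]
  simp only [openPart, Set.mem_insert_iff, true_or, if_true, Set.mem_sdiff, Set.mem_singleton_iff,
    not_true_eq_false, and_false, if_false, zero_mul, lintegral_zero, mul_zero, add_zero]
  rw [lintegral_const_mul' _ _ ENNReal.ofReal_ne_top, ← mul_assoc,
    ← ENNReal.ofReal_mul (p e).2.1, mul_openIncr_eq]

theorem lintegral_closedPart_mul (p : E → I) {F : E → ℝ} (e : E)
    {h : Set E → ℝ≥0∞} (hh : Measurable h) :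
    ∫⁻ ω, closedPart F (p, ω) e * h ω ∂(quenchedLaw p) =
      ENNReal.ofReal (F e * √(p e * (1 - p e))) * ∫⁻ ω, h (ω \ {e}) ∂(quenchedLaw p) := by
  have hm : Measurable fun ω : Set E => closedPart F (p, ω) e * h ω :=
    ((measurable_closedPart F e).comp measurable_prodMk_left).mul hh
  rw [lintegral_quenchedLaw_resample p e hm]
  simp only [closedPart, Set.mem_insert_iff, true_or, if_true, Set.mem_sdiff,
    Set.mem_singleton_iff, not_true_eq_false, and_false, if_false, zero_mul, lintegral_zero,
    mul_zero, zero_add]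
  rw [lintegral_const_mul' _ _ ENNReal.ofReal_ne_top, ← mul_assoc,
    ← ENNReal.ofReal_mul (sub_nonneg.2 (p e).2.2), mul_closedIncr_eq]

theorem measurable_twoArm_integrand [Countable V] [Countable E] (e : E) (n : ℕ) :
    Measurable ({x : (E → I) × Set E | G.TwoArm e n x.2}.indicator
      fun x => odds (x.1 e) ^ (1 / 2 : ℝ)) := by
  have h : Measurable fun x : (E → I) × Set E => odds (x.1 e) :=
    measurable_odds.comp ((measurable_pi_apply e).comp measurable_fst)
  exact (h.pow_const _).indicator (measurable_snd (measurableSet_twoArm e n))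

theorem measurable_twoArm_integrand_right [Countable V] [Countable E] (p : E → I) (e : E)
    (n : ℕ) : Measurable fun ω : Set E => {x : (E → I) × Set E | G.TwoArm e n x.2}.indicator
      (fun x => odds (x.1 e) ^ (1 / 2 : ℝ)) (p, ω) :=
  (measurable_twoArm_integrand e n).comp measurable_prodMk_left

/-- The two-arm event forces `e` to be closed. -/
theorem TwoArm.notMem {e : E} {n : ℕ} {ω : Set E} (h : G.TwoArm e n ω) : e ∉ ω := by
  obtain ⟨x, y, hxy, hne, -⟩ := h
  exact fun he => cluster_ne_iff.1 hne (mem_cluster_of_ends he hxy)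

theorem lintegral_twoArm [Countable V] [Countable E] (p : E → I) (e : E) (n : ℕ) :
    ∫⁻ ω, {x : (E → I) × Set E | G.TwoArm e n x.2}.indicator
        (fun x => odds (x.1 e) ^ (1 / 2 : ℝ)) (p, ω) ∂(quenchedLaw p) =
      ENNReal.ofReal √(p e * (1 - p e)) *
        ∫⁻ ω, {ω | G.TwoArm e n ω}.indicator 1 (ω \ {e}) ∂(quenchedLaw p) := by
  classical
  rw [lintegral_quenchedLaw_resample p e (measurable_twoArm_integrand_right p e n)]
  -- If `p e = 1` then `odds (p e) = ∞`, but the indicator vanishes when `e` is open.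
  have h1 : ∀ ω : Set E, {x : (E → I) × Set E | G.TwoArm e n x.2}.indicator
      (fun x => odds (x.1 e) ^ (1 / 2 : ℝ)) (p, insert e ω) = 0 := by
    intro ω
    have h : ¬ G.TwoArm e n (insert e ω) := fun h => h.notMem (Set.mem_insert e ω)
    rw [Set.indicator_of_notMem (by exact h)]
  have h2 : ∀ ω : Set E, {x : (E → I) × Set E | G.TwoArm e n x.2}.indicator
      (fun x => odds (x.1 e) ^ (1 / 2 : ℝ)) (p, ω \ {e}) =
      odds (p e) ^ (1 / 2 : ℝ) * {ω | G.TwoArm e n ω}.indicator 1 (ω \ {e}) := by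
    intro ω
    by_cases h : G.TwoArm e n (ω \ {e})
    · rw [Set.indicator_of_mem (by exact h), Set.indicator_of_mem (by exact h), Pi.one_apply,
        mul_one]
    · rw [Set.indicator_of_notMem (by exact h), Set.indicator_of_notMem (by exact h), mul_zero]
  have hm : Measurable fun ω : Set E =>
      {ω : Set E | G.TwoArm e n ω}.indicator (1 : Set E → ℝ≥0∞) (ω \ {e}) :=
    (measurable_one.indicator (measurableSet_twoArm e n)).comp (measurable_sdiff_singleton_set e)
  simp_rw [h1, h2]
  rw [lintegral_zero, mul_zero, zero_add, lintegral_const_mul _ hm, ← mul_assoc,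
    ofReal_mul_odds_rpow]

theorem twoArmExpectation_eq [Countable V] [Countable E] (μ : Measure (E → I))
    [IsProbabilityMeasure μ] (e : E) (n : ℕ) :
    G.twoArmExpectation μ e n = ∫⁻ p, ENNReal.ofReal √(p e * (1 - p e)) *
        ∫⁻ ω, {ω | G.TwoArm e n ω}.indicator 1 (ω \ {e}) ∂(quenchedLaw p) ∂μ := by
  rw [twoArmExpectation, lintegral_percLaw (measurable_twoArm_integrand e n)]
  exact lintegral_congr fun p => lintegral_twoArm p e n

theorem twoArmExpectation_le_one [Countable V] [Countable E] (μ : Measure (E → I))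
    [IsProbabilityMeasure μ] (e : E) (n : ℕ) : G.twoArmExpectation μ e n ≤ 1 := by
  classical
  rw [twoArmExpectation_eq]
  calc _ ≤ ∫⁻ _p, 1 ∂μ := by
        refine lintegral_mono fun p => mul_le_one' ?_ ?_
        · rw [ENNReal.ofReal_le_one, Real.sqrt_le_one]
          exact mul_le_one₀ (p e).2.2 (sub_nonneg.2 (p e).2.2) (sub_le_self _ (p e).2.1)
        · refine (lintegral_mono (g := fun _ => 1) fun ω =>
            Set.indicator_le_self' (f := 1) (fun _ _ => zero_le) _).trans ?_
          simp
    _ = 1 := by simp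

theorem twoArmExpectation_of_isDiag (μ : Measure (E → I)) {e : E} (he : (G.ends e).IsDiag)
    (n : ℕ) : G.twoArmExpectation μ e n = 0 := by
  have : {x : (E → I) × Set E | G.TwoArm e n x.2} = ∅ := by
    refine Set.eq_empty_of_forall_notMem fun x => ?_
    rintro ⟨a, b, hab, hne, -⟩
    rw [hab, Sym2.mk_isDiag_iff] at he
    exact hne (by rw [he])
  rw [twoArmExpectation, this]
  simp

theorem twoArmExpectation_edge [Countable V] [Countable E] {Γ : Subgroup G.Aut}
    {μ : Measure (E → I)} [IsProbabilityMeasure μ] (hinv : IsInvariantEnv Γ μ) {γ : G.Aut}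
    (hγ : γ ∈ Γ) (e : E) (n : ℕ) :
    G.twoArmExpectation μ (Aut.edge γ e) n = G.twoArmExpectation μ e n := by
  classical
  rw [twoArmExpectation, twoArmExpectation,
    ← (measurePreserving_mapPair hinv hγ).lintegral_comp (measurable_twoArm_integrand _ _)]
  refine lintegral_congr fun x => ?_
  simp only [Set.indicator_apply, Set.mem_ofPred_eq, Aut.mapPair_fst_edge]
  simp only [Aut.mapPair, twoArm_mapConfig]

/-- Opening `e` merges the clusters at its endpoints, so the open increments carry less cluster
mass than the closed ones; the two-arm expectation is a lower bound for the loss. -/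
theorem lintegral_openPart_add_le [Countable V] [Countable E] (μ : Measure (E → I))
    [IsProbabilityMeasure μ] {F : E → ℝ} (hF : ∀ e, 0 ≤ F e) {n : ℕ} (hn : 1 ≤ n) (e : E) :
    ∫⁻ x, openPart F x e * edgeMass G n x.2 e ∂(percLaw μ) +
        ENNReal.ofReal (F e) * G.twoArmExpectation μ e n ≤
      ∫⁻ x, closedPart F x e * edgeMass G n x.2 e ∂(percLaw μ) := by
  have hm := measurable_edgeMass (G := G) n e
  have hm2 : Measurable fun x : (E → I) × Set E => edgeMass G n x.2 e := hm.comp measurable_snd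
  have ho : Measurable fun x : (E → I) × Set E => openPart F x e * edgeMass G n x.2 e :=
    (measurable_openPart F e).mul hm2
  have hc : Measurable fun x : (E → I) × Set E => closedPart F x e * edgeMass G n x.2 e :=
    (measurable_closedPart F e).mul hm2
  have hoa : Measurable fun x : (E → I) × Set E => openPart F x e * edgeMass G n x.2 e +
      ENNReal.ofReal (F e) * {x : (E → I) × Set E | G.TwoArm e n x.2}.indicator
        (fun x => odds (x.1 e) ^ (1 / 2 : ℝ)) x :=
    ho.add ((measurable_twoArm_integrand e n).const_mul _)
  rw [twoArmExpectation, ← lintegral_const_mul _ (measurable_twoArm_integrand e n),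
    ← lintegral_add_left ho, lintegral_percLaw hc, lintegral_percLaw hoa]
  refine lintegral_mono fun p => ?_
  have hop : Measurable fun ω : Set E => openPart F (p, ω) e * edgeMass G n ω e :=
    ho.comp measurable_prodMk_left
  have hmi : Measurable fun ω : Set E => edgeMass G n (insert e ω) e :=
    hm.comp (measurable_insert_set e)
  rw [lintegral_add_left hop, lintegral_const_mul _
    (measurable_twoArm_integrand_right p e n),
    lintegral_openPart_mul p e hm, lintegral_closedPart_mul p e hm, lintegral_twoArm,
    ← mul_assoc, ← ENNReal.ofReal_mul (hF e), ← mul_add,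
    ← lintegral_add_left hmi]
  gcongr with ω
  have := edgeMass_insert_add_le (G := G) hn (ω \ {e}) e
  rwa [Set.insert_sdiff_singleton] at this

theorem lintegral_openPart_mul_edgeMass_le [Countable V] [Countable E] (μ : Measure (E → I))
    [IsProbabilityMeasure μ] {F : E → ℝ} (hF : ∀ e, 0 ≤ F e) {n : ℕ} (hn : 1 ≤ n) (e : E) :
    ∫⁻ x, openPart F x e * edgeMass G n x.2 e ∂(percLaw μ) ≤ ENNReal.ofReal (F e) * 2 := by
  have hm := measurable_edgeMass (G := G) n e
  have ho : Measurable fun x : (E → I) × Set E => openPart F x e * edgeMass G n x.2 e :=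
    (measurable_openPart F e).mul (hm.comp measurable_snd)
  rw [lintegral_percLaw ho]
  calc _ ≤ ∫⁻ _p, ENNReal.ofReal (F e) * 2 ∂μ := by
        refine lintegral_mono fun p => ?_
        rw [lintegral_openPart_mul p e hm]
        have hs : √((p e : ℝ) * (1 - p e)) ≤ 1 := by
          rw [Real.sqrt_le_one]
          exact mul_le_one₀ (p e).2.2 (sub_nonneg.2 (p e).2.2) (sub_le_self _ (p e).2.1)
        gcongr
        · exact mul_le_of_le_one_right (hF e) hs
        · calc _ ≤ ∫⁻ _ω, 2 ∂(quenchedLaw p) := lintegral_mono fun ω => edgeMass_le_two hn _ _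
            _ = 2 := by simp
    _ = _ := by simp

theorem openSum_eq_tsum (p : E → I) (F : E → ℝ) (ω : Set E) (v : V)
    [DecidablePred fun e => ∃ u ∈ G.cluster ω v, u ∈ G.ends e] :
    openSum G p F ω v =
      ∑' e, if ∃ u ∈ G.cluster ω v, u ∈ G.ends e then openPart F (p, ω) e else 0 := by
  refine tsum_congr fun e => ?_
  by_cases h : ∃ u ∈ G.cluster ω v, u ∈ G.ends e <;> by_cases h' : e ∈ ω <;>
    simp only [h, h', openPart, and_false, and_true, if_true, if_false]

theorem closedSum_eq_tsum (p : E → I) (F : E → ℝ) (ω : Set E) (v : V)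
    [DecidablePred fun e => ∃ u ∈ G.cluster ω v, u ∈ G.ends e] :
    closedSum G p F ω v =
      ∑' e, if ∃ u ∈ G.cluster ω v, u ∈ G.ends e then closedPart F (p, ω) e else 0 := by
  refine tsum_congr fun e => ?_
  by_cases h : ∃ u ∈ G.cluster ω v, u ∈ G.ends e <;> by_cases h' : e ∈ ω <;>
    simp only [h, h', closedPart, true_and, false_and, not_true_eq_false, not_false_eq_true,
      if_true, if_false]

theorem measurable_openSum [Countable V] [Countable E] (F : E → ℝ) (v : V) :
    Measurable fun x : (E → I) × Set E => openSum G x.1 F x.2 v := by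
  classical
  simp_rw [openSum_eq_tsum]
  exact Measurable.tsum fun e => Measurable.ite (measurable_snd (measurableSet_touches e v))
    (measurable_openPart F e) measurable_const

theorem measurable_closedSum [Countable V] [Countable E] (F : E → ℝ) (v : V) :
    Measurable fun x : (E → I) × Set E => closedSum G x.1 F x.2 v := by
  classical
  simp_rw [closedSum_eq_tsum]
  exact Measurable.tsum fun e => Measurable.ite (measurable_snd (measurableSet_touches e v))
    (measurable_closedPart F e) measurable_const

/-- The weighted two-arm expectations at `o` are controlled by the discrepancy between the closed
and open sums over the cluster of `o`. -/
theorem tsum_twoArmExpectation_le [Countable V] [Countable E] {Γ : Subgroup G.Aut}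
    (htrans : IsTransitive Γ) (hunim : IsUnimodular Γ) {μ : Measure (E → I)}
    [IsProbabilityMeasure μ] (hinv : IsInvariantEnv Γ μ) {F : E → ℝ} (hF : ∀ e, 0 ≤ F e)
    (hFinv : ∀ γ ∈ Γ, ∀ e, F (Aut.edge γ e) = F e)
    (hFdiag : ∀ e, (G.ends e).IsDiag → F e = 0) (o : V)
    (hfin : ∑' e : G.edgesAt o, ENNReal.ofReal (F e) ≠ ∞) {n : ℕ} (hn : 1 ≤ n) :
    ∑' e : G.edgesAt o, ENNReal.ofReal (F e) * G.twoArmExpectation μ e n ≤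
      2 * ∫⁻ x, sizeWeight n (G.cluster x.2 o).encard *
        (closedSum G x.1 F x.2 o - openSum G x.1 F x.2 o) ∂(percLaw μ) := by
  classical
  have ho := two_mul_lintegral_sizeWeight_mul htrans hunim hinv (X := openPart F)
    (measurable_openPart F)
    (fun γ hγ x e => by
      simp only [openPart, openIncr, Aut.mapPair_fst_edge, hFinv γ hγ]
      simp only [Aut.mapPair, Aut.edge_mem_mapConfig])
    (fun x e he => by simp [openPart, openIncr, hFdiag e he]) n o
  have hc := two_mul_lintegral_sizeWeight_mul htrans hunim hinv (X := closedPart F)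
    (measurable_closedPart F)
    (fun γ hγ x e => by
      simp only [closedPart, closedIncr, Aut.mapPair_fst_edge, hFinv γ hγ]
      simp only [Aut.mapPair, Aut.edge_mem_mapConfig])
    (fun x e he => by simp [closedPart, closedIncr, hFdiag e he]) n o
  have hfinite : ∑' e : G.edgesAt o, ∫⁻ x, openPart F x e * edgeMass G n x.2 e ∂(percLaw μ)
      ≠ ∞ := by
    refine ne_top_of_le_ne_top ?_ (ENNReal.tsum_le_tsum fun e : G.edgesAt o =>
      lintegral_openPart_mul_edgeMass_le μ hF hn e)
    rw [ENNReal.tsum_mul_right]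
    exact ENNReal.mul_ne_top hfin (by simp)
  refine (ENNReal.add_le_add_iff_left hfinite).1 ?_
  rw [← ENNReal.tsum_add]
  refine (ENNReal.tsum_le_tsum fun e : G.edgesAt o =>
    lintegral_openPart_add_le μ hF hn e).trans ?_
  rw [← ho, ← hc, ← mul_add]
  simp_rw [← openSum_eq_tsum, ← closedSum_eq_tsum]
  have hsw : Measurable fun x : (E → I) × Set E => sizeWeight n (G.cluster x.2 o).encard :=
    (measurable_sizeWeight_cluster n o).comp measurable_snd
  have hso : Measurable fun x : (E → I) × Set E =>
      sizeWeight n (G.cluster x.2 o).encard * openSum G x.1 F x.2 o :=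
    hsw.mul (measurable_openSum F o)
  rw [← lintegral_add_left hso]
  gcongr with x
  rw [← mul_add]
  gcongr
  exact le_add_tsub

/-! ### Power sums -/

theorem sum_range_rpow_sub_one_le {r : ℝ} (hr0 : 0 < r) (hr1 : r ≤ 1) (m : ℕ) :
    ∑ j ∈ Finset.range m, ((j + 1 : ℕ) : ℝ) ^ (r - 1) ≤ (m : ℝ) ^ r / r := by
  induction m with
  | zero => simp [Real.zero_rpow hr0.ne']
  | succ m ih =>
    rw [Finset.sum_range_succ]
    refine (add_le_add_left ih _).trans ?_
    have hm : (0 : ℝ) < (m + 1 : ℕ) := by positivity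
    have hm0 : (0 : ℝ) ≤ m := by positivity
    have hs : (-1 : ℝ) ≤ -(1 / ((m + 1 : ℕ) : ℝ)) := by
      rw [neg_le_neg_iff, div_le_one hm]
      push_cast
      linarith
    -- Bernoulli's inequality for `(1 - 1 / (m + 1)) ^ r`.
    have hb := rpow_one_add_le_one_add_mul_self hs hr0.le hr1
    have heq : (m : ℝ) = ((m + 1 : ℕ) : ℝ) * (1 + -(1 / ((m + 1 : ℕ) : ℝ))) := by
      field_simp
      push_cast
      ring
    have hpow : (m : ℝ) ^ r = ((m + 1 : ℕ) : ℝ) ^ r * (1 + -(1 / ((m + 1 : ℕ) : ℝ))) ^ r := by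
      rw [← Real.mul_rpow hm.le (by linarith), ← heq]
    have h1 : ((m + 1 : ℕ) : ℝ) ^ (r - 1) = ((m + 1 : ℕ) : ℝ) ^ r * (1 / ((m + 1 : ℕ) : ℝ)) := by
      rw [Real.rpow_sub_one hm.ne']
      ring
    rw [le_div_iff₀ hr0, add_mul, div_mul_cancel₀ _ hr0.ne', h1, hpow]
    have := mul_le_mul_of_nonneg_left hb (Real.rpow_nonneg hm.le r)
    linarith

/-- The weight `k ^ (-1/2)` for `k ≤ n`, continued by a multiple of `k ^ (-2)` for `k > n`. -/
noncomputable def momentWeight (n k : ℕ) : ℝ :=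
  if k ≤ n then (√k)⁻¹ else n * √n / (k : ℝ) ^ 2

theorem momentWeight_nonneg (n k : ℕ) : 0 ≤ momentWeight n k := by
  unfold momentWeight
  split_ifs <;> positivity

theorem momentWeight_succ_le (n k : ℕ) (hk : 1 ≤ k) :
    momentWeight n (k + 1) ≤ momentWeight n k := by
  have hk0 : (0 : ℝ) < k := by exact_mod_cast hk
  unfold momentWeight
  split_ifs with h1 h2 h2
  · have : √(k : ℝ) ≤ √((k + 1 : ℕ) : ℝ) := Real.sqrt_le_sqrt (by push_cast; linarith)
    exact inv_anti₀ (Real.sqrt_pos.2 hk0) this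
  · omega
  · obtain rfl : n = k := by omega
    have hs := Real.sqrt_pos.2 hk0
    rw [div_le_iff₀ (by positivity), inv_mul_eq_div, le_div_iff₀ hs, mul_assoc,
      Real.mul_self_sqrt hk0.le]
    push_cast
    nlinarith
  · refine div_le_div_of_nonneg_left (by positivity) (by positivity) ?_
    push_cast
    nlinarith

theorem sum_momentWeight_mul_rpow_le {θ : ℝ} (hθ0 : 0 ≤ θ) (hθ : θ < 1 / 2) {n : ℕ} (hn : 1 ≤ n)
    (m : ℕ) :
    ∑ j ∈ Finset.range m, momentWeight n (j + 1) * ((j + 1 : ℕ) : ℝ) ^ (-θ) ≤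
      ((1 / 2 - θ)⁻¹ + 1) * (n : ℝ) ^ (1 / 2 - θ) := by
  have hr : 0 < 1 / 2 - θ := by linarith
  have hn0 : (0 : ℝ) < n := by exact_mod_cast hn
  have hsmall : ∀ m ≤ n, ∑ j ∈ Finset.range m, momentWeight n (j + 1) *
      ((j + 1 : ℕ) : ℝ) ^ (-θ) ≤ (1 / 2 - θ)⁻¹ * (n : ℝ) ^ (1 / 2 - θ) := by
    intro m hm
    calc _ = ∑ j ∈ Finset.range m, ((j + 1 : ℕ) : ℝ) ^ ((1 / 2 - θ) - 1) := by
          refine Finset.sum_congr rfl fun j hj => ?_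
          have hj0 : (0 : ℝ) < (j + 1 : ℕ) := by positivity
          have hjn : j + 1 ≤ n := (Finset.mem_range.1 hj).trans_le hm
          rw [momentWeight, if_pos hjn, Real.sqrt_eq_rpow, ← Real.rpow_neg hj0.le,
            ← Real.rpow_add hj0]
          congr 1
          ring
      _ ≤ (m : ℝ) ^ (1 / 2 - θ) / (1 / 2 - θ) := sum_range_rpow_sub_one_le hr (by linarith) m
      _ ≤ (n : ℝ) ^ (1 / 2 - θ) / (1 / 2 - θ) := by gcongr
      _ = _ := by rw [div_eq_inv_mul]
  have hlarge : ∀ m ≥ n, ∑ j ∈ Finset.range m, momentWeight n (j + 1) *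
      ((j + 1 : ℕ) : ℝ) ^ (-θ) ≤ (1 / 2 - θ)⁻¹ * (n : ℝ) ^ (1 / 2 - θ) +
        (n : ℝ) ^ (1 / 2 - θ) * (1 - n / m) := by
    intro m hm
    induction m, hm using Nat.le_induction with
    | base =>
      rw [div_self hn0.ne', sub_self, mul_zero, add_zero]
      exact hsmall n le_rfl
    | succ m hm ih =>
      have hm0 : (0 : ℝ) < m := hn0.trans_le (by exact_mod_cast hm)
      have hm1 : (0 : ℝ) < (m + 1 : ℕ) := by positivity
      rw [Finset.sum_range_succ, momentWeight, if_neg (by omega)]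
      have hpow : ((m + 1 : ℕ) : ℝ) ^ (-θ) ≤ (n : ℝ) ^ (-θ) :=
        Real.rpow_le_rpow_of_nonpos hn0 (by exact_mod_cast hm.trans (Nat.le_succ m)) (by linarith)
      have hsplit : (n : ℝ) ^ (1 / 2 - θ) = √n * (n : ℝ) ^ (-θ) := by
        rw [Real.sqrt_eq_rpow, ← Real.rpow_add hn0]
        congr 1
      have hinc : n * √n / ((m + 1 : ℕ) : ℝ) ^ 2 * ((m + 1 : ℕ) : ℝ) ^ (-θ) ≤
          (n : ℝ) ^ (1 / 2 - θ) * (n / m - n / (m + 1 : ℕ)) := by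
        calc _ ≤ n * √n / ((m + 1 : ℕ) : ℝ) ^ 2 * (n : ℝ) ^ (-θ) := by gcongr
          _ = (n : ℝ) ^ (1 / 2 - θ) * (n / ((m + 1 : ℕ) : ℝ) ^ 2) := by rw [hsplit]; ring
          _ ≤ _ := by
            gcongr
            rw [div_sub_div _ _ hm0.ne' hm1.ne', div_le_div_iff₀ (by positivity) (by positivity)]
            push_cast
            nlinarith [mul_pos hn0 hm0]
      linarith
  rcases le_total m n with h | h
  · refine (hsmall m h).trans ?_
    rw [add_mul]
    have : 0 ≤ (n : ℝ) ^ (1 / 2 - θ) := by positivity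
    linarith
  · refine (hlarge m h).trans ?_
    have h1 : 0 ≤ (n : ℝ) ^ (1 / 2 - θ) := by positivity
    have h2 : 0 ≤ (n : ℝ) / m := by positivity
    nlinarith [mul_nonneg h1 h2]

theorem sqrt_le_sum_inv_sqrt (m : ℕ) :
    √(m : ℝ) ≤ ∑ j ∈ Finset.range m, (√((j + 1 : ℕ) : ℝ))⁻¹ := by
  induction m with
  | zero => simp
  | succ m ih =>
    rw [Finset.sum_range_succ]
    refine le_trans ?_ (add_le_add_left ih _)
    have h1 : (0 : ℝ) < √((m + 1 : ℕ) : ℝ) := Real.sqrt_pos.2 (by positivity)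
    have h2 : √(m : ℝ) ≤ √((m + 1 : ℕ) : ℝ) := Real.sqrt_le_sqrt (by push_cast; linarith)
    have h3 : √((m + 1 : ℕ) : ℝ) ^ 2 = m + 1 := by
      rw [Real.sq_sqrt (by positivity)]; push_cast; ring
    have h4 : √(m : ℝ) ^ 2 = m := Real.sq_sqrt (by positivity)
    have h5 : √((m + 1 : ℕ) : ℝ) * (√((m + 1 : ℕ) : ℝ))⁻¹ = 1 := mul_inv_cancel₀ h1.ne'
    refine le_of_mul_le_mul_left ?_ h1
    rw [mul_add, h5]
    nlinarith [Real.sqrt_nonneg (m : ℝ)]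

/-! ### Bounding the discrepancy by Cauchy–Schwarz -/

theorem measurableSet_tail [Countable V] [Countable E] (o : V) (j : ℕ) :
    MeasurableSet {x : (E → I) × Set E | (j : ℕ∞) ≤ (G.cluster x.2 o).encard} :=
  measurable_snd (measurableSet_le_encard_cluster j o)

theorem lintegral_quenchedLaw_tail [Countable V] [Countable E] (μ : Measure (E → I))
    [IsProbabilityMeasure μ] (o : V) (j : ℕ) :
    ∫⁻ p, quenchedLaw p {ω | (j : ℕ∞) ≤ (G.cluster ω o).encard} ∂μ =
      percLaw μ {x | (j : ℕ∞) ≤ (G.cluster x.2 o).encard} := by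
  rw [← lintegral_indicator_one (measurableSet_tail o j),
    lintegral_percLaw (measurable_one.indicator (measurableSet_tail o j))]
  refine lintegral_congr fun p => ?_
  rw [← lintegral_indicator_one (measurableSet_le_encard_cluster j o)]
  rfl

theorem measurable_quenchedLaw_tail [Countable V] [Countable E] (o : V) (j : ℕ) :
    Measurable fun p : E → I => quenchedLaw p {ω | (j : ℕ∞) ≤ (G.cluster ω o).encard} := by
  have h := measurable_measure_prodMk_left (ν := labelLaw E)
    (measurable_openEdges (E := E) (measurableSet_tail (G := G) o j))
  have heq : (fun p : E → I => quenchedLaw p {ω | (j : ℕ∞) ≤ (G.cluster ω o).encard}) =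
      fun p => labelLaw E (Prod.mk p ⁻¹'
        ((fun x : (E → I) × (E → I) => (x.1, openEdges x.1 x.2)) ⁻¹'
        {x | (j : ℕ∞) ≤ (G.cluster x.2 o).encard})) := by
    funext p
    rw [quenchedLaw, Measure.map_apply (measurable_openEdges_right p)
      (measurableSet_le_encard_cluster j o)]
    rfl
  rw [heq]
  exact h

/-- The weight decays like `k ^ (-1/2)` up to `n` and like `k ^ (-2)` beyond, so both parts of the
sum are of the order `n ^ (1/2 - θ)` reached at `k = n`. -/
theorem tsum_momentWeight_mul_le {μ : Measure ((E → I) × Set E)} {o : V} {A θ : ℝ} (hA : 0 ≤ A)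
    (hθ0 : 0 ≤ θ) (hθ : θ < 1 / 2)
    (htail : ∀ j : ℕ, 1 ≤ j → μ {x | (j : ℕ∞) ≤ (G.cluster x.2 o).encard} ≤
      ENNReal.ofReal (A * (j : ℝ) ^ (-θ))) {n : ℕ} (hn : 1 ≤ n) :
    ∑' j : ℕ, ENNReal.ofReal (momentWeight n (j + 1)) *
        μ {x | ((j + 1 : ℕ) : ℕ∞) ≤ (G.cluster x.2 o).encard} ≤
      ENNReal.ofReal (A * (((1 / 2 - θ)⁻¹ + 1) * (n : ℝ) ^ (1 / 2 - θ))) := by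
  refine ENNReal.tsum_le_of_sum_range_le fun m => ?_
  calc _ ≤ ∑ j ∈ Finset.range m, ENNReal.ofReal
          (A * (momentWeight n (j + 1) * ((j + 1 : ℕ) : ℝ) ^ (-θ))) := by
        refine Finset.sum_le_sum fun j _ => ?_
        refine (mul_le_mul_right (htail (j + 1) (by omega)) _).trans_eq ?_
        rw [← ENNReal.ofReal_mul (momentWeight_nonneg _ _)]
        congr 1
        ring
    _ = ENNReal.ofReal (A * ∑ j ∈ Finset.range m,
          momentWeight n (j + 1) * ((j + 1 : ℕ) : ℝ) ^ (-θ)) := by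
        rw [Finset.mul_sum, ENNReal.ofReal_sum_of_nonneg]
        intro j _
        have := momentWeight_nonneg n (j + 1)
        positivity
    _ ≤ _ := ENNReal.ofReal_le_ofReal
        (mul_le_mul_of_nonneg_left (sum_momentWeight_mul_rpow_le hθ0 hθ hn m) hA)

/-- The second Cauchy–Schwarz factor: `√(min k n) / n ^ 2` is the square of the vertex weight
divided by `momentWeight n k`. -/
theorem lintegral_sqrt_min_le [Countable V] [Countable E] {μ : Measure ((E → I) × Set E)} {o : V}
    {A θ : ℝ} (hA : 0 ≤ A) (hθ0 : 0 ≤ θ) (hθ : θ < 1 / 2)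
    (htail : ∀ j : ℕ, 1 ≤ j → μ {x | (j : ℕ∞) ≤ (G.cluster x.2 o).encard} ≤
      ENNReal.ofReal (A * (j : ℝ) ^ (-θ))) {n : ℕ} :
    ∫⁻ x, {x : (E → I) × Set E | (G.cluster x.2 o).Finite}.indicator (fun x =>
        ENNReal.ofReal (√(min (G.cluster x.2 o).ncard n : ℕ) / (n : ℝ) ^ 2)) x ∂μ ≤
      ENNReal.ofReal (A * ((1 / 2 - θ)⁻¹ * (n : ℝ) ^ (1 / 2 - θ)) / (n : ℝ) ^ 2) := by
  have hr : 0 < 1 / 2 - θ := by linarith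
  calc _ ≤ ∫⁻ x, ENNReal.ofReal (1 / (n : ℝ) ^ 2) * ∑ j ∈ Finset.range n,
        ENNReal.ofReal ((√((j + 1 : ℕ) : ℝ))⁻¹) *
          {x : (E → I) × Set E | ((j + 1 : ℕ) : ℕ∞) ≤ (G.cluster x.2 o).encard}.indicator 1 x
          ∂μ := by
        refine lintegral_mono fun x => ?_
        by_cases hfin : (G.cluster x.2 o).Finite
        · rw [Set.indicator_of_mem (by exact hfin)]
          rw [div_eq_mul_one_div, mul_comm, ENNReal.ofReal_mul (by positivity)]
          gcongr
          refine (ENNReal.ofReal_le_ofReal (sqrt_le_sum_inv_sqrt _)).trans ?_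
          rw [ENNReal.ofReal_sum_of_nonneg fun j _ => by positivity]
          calc _ ≤ ∑ j ∈ Finset.range (min (G.cluster x.2 o).ncard n),
                ENNReal.ofReal ((√((j + 1 : ℕ) : ℝ))⁻¹) *
                {x : (E → I) × Set E | ((j + 1 : ℕ) : ℕ∞) ≤
                  (G.cluster x.2 o).encard}.indicator 1 x := by
                refine Finset.sum_le_sum fun j hj => ?_
                have hj' : ((j + 1 : ℕ) : ℕ∞) ≤ (G.cluster x.2 o).encard := by
                  rw [← hfin.cast_ncard_eq]
                  exact Nat.cast_le.2 ((Finset.mem_range.1 hj).trans_le (min_le_left _ _))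
                rw [Set.indicator_of_mem (by exact hj'), Pi.one_apply, mul_one]
            _ ≤ _ := Finset.sum_le_sum_of_subset
                (Finset.range_mono (min_le_right _ _))
        · rw [Set.indicator_of_notMem (by exact hfin)]
          exact zero_le
    _ = ENNReal.ofReal (1 / (n : ℝ) ^ 2) * ∑ j ∈ Finset.range n,
        ENNReal.ofReal ((√((j + 1 : ℕ) : ℝ))⁻¹) *
          μ {x | ((j + 1 : ℕ) : ℕ∞) ≤ (G.cluster x.2 o).encard} := by
        rw [lintegral_const_mul' _ _ ENNReal.ofReal_ne_top, lintegral_finsetSum _ fun j _ =>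
          ((measurable_one.indicator (measurableSet_tail o (j + 1))).const_mul _)]
        congr 1
        refine Finset.sum_congr rfl fun j _ => ?_
        rw [lintegral_const_mul' _ _ ENNReal.ofReal_ne_top,
          lintegral_indicator_one (measurableSet_tail o (j + 1))]
    _ ≤ ENNReal.ofReal (1 / (n : ℝ) ^ 2) * ∑ j ∈ Finset.range n,
        ENNReal.ofReal (A * ((j + 1 : ℕ) : ℝ) ^ ((1 / 2 - θ) - 1)) := by
        gcongr with j hj
        refine (mul_le_mul_right (htail (j + 1) (by omega)) _).trans_eq ?_
        have hj0 : (0 : ℝ) < (j + 1 : ℕ) := by positivity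
        rw [← ENNReal.ofReal_mul (by positivity), Real.sqrt_eq_rpow, ← Real.rpow_neg hj0.le,
          mul_left_comm, ← Real.rpow_add hj0]
        congr 3
        ring
    _ = ENNReal.ofReal (1 / (n : ℝ) ^ 2 * (A * ∑ j ∈ Finset.range n,
        ((j + 1 : ℕ) : ℝ) ^ ((1 / 2 - θ) - 1))) := by
        rw [ENNReal.ofReal_mul (by positivity), Finset.mul_sum _ _ A, ENNReal.ofReal_sum_of_nonneg]
        intro j _
        positivity
    _ ≤ _ := by
        refine ENNReal.ofReal_le_ofReal ?_
        rw [one_div, inv_mul_eq_div]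
        gcongr
        exact (sum_range_rpow_sub_one_le hr (by linarith) n).trans_eq (div_eq_inv_mul _ _)

/-- The factorization of the vertex weight to which the Cauchy–Schwarz inequality is applied. -/
theorem sizeWeight_eq_mul {n : ℕ} (hn : 1 ≤ n) {k : ℕ} (hk : 1 ≤ k) :
    sizeWeight n k = ENNReal.ofReal √(momentWeight n k) *
      ENNReal.ofReal √(√(min k n : ℕ) / (n : ℝ) ^ 2) := by
  have hn0 : (0 : ℝ) < n := by exact_mod_cast hn
  have hk0 : (0 : ℝ) < k := by exact_mod_cast hk
  have h1 : sizeWeight n k = ENNReal.ofReal ((max n k : ℕ) : ℝ)⁻¹ := by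
    rw [ENNReal.ofReal_inv_of_pos (by exact_mod_cast lt_max_of_lt_left hn), sizeWeight,
      ENNReal.ofReal_natCast]
    rfl
  rw [h1, ← ENNReal.ofReal_mul (Real.sqrt_nonneg _),
    ← Real.sqrt_mul (momentWeight_nonneg n k)]
  congr 1
  symm
  rw [Real.sqrt_eq_iff_mul_self_eq (by have := momentWeight_nonneg n k; positivity)
    (by positivity), momentWeight]
  split_ifs with h
  · rw [max_eq_left h, min_eq_left h]
    have := Real.sqrt_pos.2 hk0
    field_simp
  · rw [max_eq_right (by omega), min_eq_right (by omega)]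
    have h2 : √(n : ℝ) * √n = n := Real.mul_self_sqrt hn0.le
    field_simp
    rw [sq, h2]

theorem measurable_ncard_cluster [Countable V] [Countable E] (o : V) :
    Measurable fun x : (E → I) × Set E => (G.cluster x.2 o).ncard := by
  simp_rw [Set.ncard_def]
  exact (Measurable.of_discrete (f := ENat.toNat)).comp
    ((measurable_encard_cluster o).comp measurable_snd)

/-- The second moment bound, averaged over the environment. -/
theorem lintegral_percLaw_sub_sq_le [Countable V] [Countable E] (μ : Measure (E → I))
    [IsProbabilityMeasure μ] {D : V → Finset E} {F : E → ℝ} {B : ℝ}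
    (hF : ∀ e, 0 ≤ F e) (hD : ∀ v e, e ∈ D v ↔ v ∈ G.ends e ∧ F e ≠ 0)
    (hB : ∀ v, ∑ e ∈ D v, F e ^ 2 ≤ B) (o : V) (n : ℕ) :
    ∫⁻ x, {x : (E → I) × Set E | (G.cluster x.2 o).Finite}.indicator (fun x =>
        ENNReal.ofReal (momentWeight n (G.cluster x.2 o).ncard) *
          (closedSum G x.1 F x.2 o - openSum G x.1 F x.2 o) ^ 2) x ∂(percLaw μ) ≤
      ENNReal.ofReal B * ∑' j : ℕ, ENNReal.ofReal (momentWeight n (j + 1)) *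
        percLaw μ {x | ((j + 1 : ℕ) : ℕ∞) ≤ (G.cluster x.2 o).encard} := by
  have hm : Measurable ({x : (E → I) × Set E | (G.cluster x.2 o).Finite}.indicator (fun x =>
        ENNReal.ofReal (momentWeight n (G.cluster x.2 o).ncard) *
          (closedSum G x.1 F x.2 o - openSum G x.1 F x.2 o) ^ 2)) := by
    refine Measurable.indicator ?_ (measurable_snd (measurableSet_finite_cluster o))
    exact ((Measurable.of_discrete (f := fun k => ENNReal.ofReal (momentWeight n k))).comp
      (measurable_ncard_cluster o)).mul
      (((measurable_closedSum F o).sub (measurable_openSum F o)).pow_const 2)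
  rw [lintegral_percLaw hm]
  refine (lintegral_mono fun p => lintegral_sub_sq_le hF hD hB (momentWeight_nonneg n)
    (momentWeight_succ_le n) p o).trans_eq ?_
  rw [lintegral_const_mul' _ _ ENNReal.ofReal_ne_top, lintegral_tsum fun j =>
    ((measurable_quenchedLaw_tail o (j + 1)).const_mul _).aemeasurable]
  congr 1
  refine tsum_congr fun j => ?_
  rw [lintegral_const_mul' _ _ ENNReal.ofReal_ne_top, lintegral_quenchedLaw_tail]

/-- The weighted discrepancy of the cluster of `o` is of the order of
`A * √B * n ^ (-1/2 - θ)`. -/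
theorem sq_lintegral_sizeWeight_mul_le [Countable V] [Countable E] (μ : Measure (E → I))
    [IsProbabilityMeasure μ] {D : V → Finset E} {F : E → ℝ} {B : ℝ}
    (hF : ∀ e, 0 ≤ F e) (hD : ∀ v e, e ∈ D v ↔ v ∈ G.ends e ∧ F e ≠ 0)
    (hB0 : 0 ≤ B) (hB : ∀ v, ∑ e ∈ D v, F e ^ 2 ≤ B) (o : V) {A θ : ℝ} (hA : 0 ≤ A)
    (hθ0 : 0 ≤ θ) (hθ : θ < 1 / 2)
    (htail : ∀ j : ℕ, 1 ≤ j → percLaw μ {x | (j : ℕ∞) ≤ (G.cluster x.2 o).encard} ≤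
      ENNReal.ofReal (A * (j : ℝ) ^ (-θ))) {n : ℕ} (hn : 1 ≤ n) :
    (∫⁻ x, sizeWeight n (G.cluster x.2 o).encard *
        (closedSum G x.1 F x.2 o - openSum G x.1 F x.2 o) ∂(percLaw μ)) ^ 2 ≤
      ENNReal.ofReal (B * (A * (((1 / 2 - θ)⁻¹ + 1) * (n : ℝ) ^ (1 / 2 - θ))) *
        (A * ((1 / 2 - θ)⁻¹ * (n : ℝ) ^ (1 / 2 - θ)) / (n : ℝ) ^ 2)) := by
  have hr : 0 < 1 / 2 - θ := by linarith
  set fin : Set ((E → I) × Set E) := {x | (G.cluster x.2 o).Finite} with hfin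
  have hfinm : MeasurableSet fin := measurable_snd (measurableSet_finite_cluster o)
  set Z : (E → I) × Set E → ℝ≥0∞ := fun x =>
    closedSum G x.1 F x.2 o - openSum G x.1 F x.2 o with hZ
  have hZm : Measurable Z := (measurable_closedSum F o).sub (measurable_openSum F o)
  set f : (E → I) × Set E → ℝ≥0∞ := fin.indicator fun x =>
    ENNReal.ofReal √(momentWeight n (G.cluster x.2 o).ncard) * Z x with hf
  set g : (E → I) × Set E → ℝ≥0∞ := fin.indicator fun x =>
    ENNReal.ofReal √(√(min (G.cluster x.2 o).ncard n : ℕ) / (n : ℝ) ^ 2) with hg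
  have hfm : Measurable f := Measurable.indicator
    (((Measurable.of_discrete (f := fun k => ENNReal.ofReal √(momentWeight n k))).comp
      (measurable_ncard_cluster o)).mul hZm) hfinm
  have hgm : Measurable g := Measurable.indicator
    ((Measurable.of_discrete (f := fun k : ℕ =>
      ENNReal.ofReal √(√(min k n : ℕ) / (n : ℝ) ^ 2))).comp (measurable_ncard_cluster o)) hfinm
  have hfg : ∀ x, sizeWeight n (G.cluster x.2 o).encard * Z x = (f * g) x := by
    intro x
    rw [Pi.mul_apply, hf, hg]
    by_cases hx : (G.cluster x.2 o).Finite
    · have hk : 1 ≤ (G.cluster x.2 o).ncard :=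
        (Set.ncard_pos hx).2 ⟨o, mem_cluster_self _ _⟩
      rw [Set.indicator_of_mem (by exact hx), Set.indicator_of_mem (by exact hx),
        ← hx.cast_ncard_eq, sizeWeight_eq_mul hn hk]
      ring
    · rw [Set.indicator_of_notMem (by exact hx), Set.indicator_of_notMem (by exact hx),
        Set.Infinite.encard_eq hx]
      simp
  have hf2 : ∀ x, f x ^ (2 : ℝ) = fin.indicator (fun x =>
      ENNReal.ofReal (momentWeight n (G.cluster x.2 o).ncard) * Z x ^ 2) x := by
    intro x
    rw [ENNReal.rpow_two, hf]
    by_cases hx : x ∈ fin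
    · rw [Set.indicator_of_mem hx, Set.indicator_of_mem hx, mul_pow,
        ← ENNReal.ofReal_pow (Real.sqrt_nonneg _), Real.sq_sqrt (momentWeight_nonneg _ _)]
    · rw [Set.indicator_of_notMem hx, Set.indicator_of_notMem hx, zero_pow two_ne_zero]
  have hg2 : ∀ x, g x ^ (2 : ℝ) = fin.indicator (fun x =>
      ENNReal.ofReal (√(min (G.cluster x.2 o).ncard n : ℕ) / (n : ℝ) ^ 2)) x := by
    intro x
    rw [ENNReal.rpow_two, hg]
    by_cases hx : x ∈ fin
    · rw [Set.indicator_of_mem hx, Set.indicator_of_mem hx,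
        ← ENNReal.ofReal_pow (Real.sqrt_nonneg _), Real.sq_sqrt (by positivity)]
    · rw [Set.indicator_of_notMem hx, Set.indicator_of_notMem hx, zero_pow two_ne_zero]
  have hCS := ENNReal.lintegral_mul_le_Lp_mul_Lq (percLaw μ) Real.HolderConjugate.two_two
    hfm.aemeasurable hgm.aemeasurable
  simp_rw [hf2, hg2] at hCS
  rw [lintegral_congr hfg]
  calc _ ≤ _ := pow_le_pow_left' hCS 2
    _ = (∫⁻ x, fin.indicator (fun x =>
          ENNReal.ofReal (momentWeight n (G.cluster x.2 o).ncard) * Z x ^ 2) x ∂(percLaw μ)) *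
        ∫⁻ x, fin.indicator (fun x =>
          ENNReal.ofReal (√(min (G.cluster x.2 o).ncard n : ℕ) / (n : ℝ) ^ 2)) x
            ∂(percLaw μ) := by
        rw [mul_pow, ← ENNReal.rpow_mul_natCast, ← ENNReal.rpow_mul_natCast]
        norm_num
    _ ≤ (ENNReal.ofReal B * ENNReal.ofReal (A * (((1 / 2 - θ)⁻¹ + 1) * (n : ℝ) ^ (1 / 2 - θ)))) *
        ENNReal.ofReal (A * ((1 / 2 - θ)⁻¹ * (n : ℝ) ^ (1 / 2 - θ)) / (n : ℝ) ^ 2) := by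
        refine mul_le_mul' ((lintegral_percLaw_sub_sq_le μ hF hD hB o n).trans ?_)
          (lintegral_sqrt_min_le hA hθ0 hθ htail)
        gcongr
        exact tsum_momentWeight_mul_le hA hθ0 hθ htail hn
    _ = _ := by
        rw [← ENNReal.ofReal_mul hB0, ← ENNReal.ofReal_mul (by positivity)]

/-! ### The two-arm inequality for truncated edge functions -/

theorem finite_edgesAt_le_J (G : WeightedGraph V E) (v : V) {ε : ℝ} (hε : 0 < ε) :
    {e | v ∈ G.ends e ∧ ε ≤ G.J e}.Finite := by
  have h := (G.summable_J v).tendsto_cofinite_zero.eventually (gt_mem_nhds hε)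
  rw [Filter.eventually_cofinite] at h
  refine (h.image Subtype.val).subset ?_
  rintro e ⟨hv, hJ⟩
  exact ⟨⟨e, hv⟩, not_lt.2 hJ, rfl⟩

theorem sum_sq_eq_of_invariant {Γ : Subgroup G.Aut} (htrans : IsTransitive Γ) {F : E → ℝ}
    (hFinv : ∀ γ ∈ Γ, ∀ e, F (Aut.edge γ e) = F e) {D : V → Finset E}
    (hD : ∀ v e, e ∈ D v ↔ v ∈ G.ends e ∧ F e ≠ 0) (o v : V) :
    ∑ e ∈ D v, F e ^ 2 = ∑ e ∈ D o, F e ^ 2 := by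
  obtain ⟨γ, hγ, rfl⟩ := htrans o v
  refine (Finset.sum_equiv (Aut.edge γ) (fun e => ?_) fun e _ => ?_).symm
  · rw [hD, hD, Aut.mem_ends_edge, hFinv γ hγ]
  · rw [hFinv γ hγ]

/-- If an invariant edge function `F` with finitely many non-zero values at each vertex is dominated
by the two-arm expectation, then the sum of its squares at a vertex satisfies the two-arm bound.
Testing against `F` itself turns the linear estimate into a quadratic one. -/
theorem sum_sq_le [Countable V] [Countable E] {Γ : Subgroup G.Aut}
    (htrans : IsTransitive Γ) (hunim : IsUnimodular Γ) {μ : Measure (E → I)}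
    [IsProbabilityMeasure μ] (hinv : IsInvariantEnv Γ μ) {o : V} {A θ : ℝ} (hA : 0 ≤ A)
    (hθ0 : 0 ≤ θ) (hθ : θ < 1 / 2)
    (htail : ∀ j : ℕ, 1 ≤ j → percLaw μ {x | (j : ℕ∞) ≤ (G.cluster x.2 o).encard} ≤
      ENNReal.ofReal (A * (j : ℝ) ^ (-θ))) {n : ℕ} (hn : 1 ≤ n) {F : E → ℝ} (hF : ∀ e, 0 ≤ F e)
    (hFinv : ∀ γ ∈ Γ, ∀ e, F (Aut.edge γ e) = F e)
    (hFle : ∀ e, ENNReal.ofReal (F e) ≤ G.twoArmExpectation μ e n) {D : V → Finset E}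
    (hD : ∀ v e, e ∈ D v ↔ v ∈ G.ends e ∧ F e ≠ 0) :
    ∑ e ∈ D o, F e ^ 2 ≤ 24 * A ^ 2 / ((1 - 2 * θ) ^ 2 * (n : ℝ) ^ (1 + 2 * θ)) := by
  classical
  have hn0 : (0 : ℝ) < n := by exact_mod_cast hn
  have hFdiag : ∀ e, (G.ends e).IsDiag → F e = 0 := by
    intro e he
    have := hFle e
    rw [twoArmExpectation_of_isDiag μ he, nonpos_iff_eq_zero, ENNReal.ofReal_eq_zero] at this
    exact le_antisymm this (hF e)
  set B := ∑ e ∈ D o, F e ^ 2 with hBdef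
  have hB0 : 0 ≤ B := Finset.sum_nonneg fun _ _ => sq_nonneg _
  have hB : ∀ v, ∑ e ∈ D v, F e ^ 2 ≤ B := fun v =>
    (sum_sq_eq_of_invariant htrans hFinv hD o v).le
  have hDo : ∀ e ∈ D o, e ∈ G.edgesAt o := fun e he => ((hD o e).1 he).1
  have hfin : ∑' e : G.edgesAt o, ENNReal.ofReal (F e) ≠ ∞ := by
    rw [tsum_subtype (G.edgesAt o) fun e => ENNReal.ofReal (F e), tsum_eq_sum (s := D o)]
    · refine ENNReal.sum_ne_top.2 fun e _ => ?_
      rw [Set.indicator_apply]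
      split_ifs
      exacts [ENNReal.ofReal_ne_top, ENNReal.zero_ne_top]
    · intro e he
      rw [Set.indicator_apply]
      split_ifs with heo
      · have : F e = 0 := by
          by_contra h0
          exact he ((hD o e).2 ⟨heo, h0⟩)
        rw [this, ENNReal.ofReal_zero]
      · rfl
  have hlower : ENNReal.ofReal B ≤
      ∑' e : G.edgesAt o, ENNReal.ofReal (F e) * G.twoArmExpectation μ e n := by
    rw [tsum_subtype (G.edgesAt o) fun e => ENNReal.ofReal (F e) * G.twoArmExpectation μ e n,
      hBdef, ENNReal.ofReal_sum_of_nonneg fun _ _ => sq_nonneg _]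
    refine le_trans (Finset.sum_le_sum fun e he => ?_) (ENNReal.sum_le_tsum (D o))
    rw [Set.indicator_of_mem (hDo e he), sq, ENNReal.ofReal_mul (hF e)]
    gcongr
    exact hFle e
  have hupper := tsum_twoArmExpectation_le htrans hunim hinv hF hFinv hFdiag o hfin hn
  have hsq := sq_lintegral_sizeWeight_mul_le μ hF hD hB0 hB o hA hθ0 hθ htail hn
  have hr : 0 < 1 / 2 - θ := by linarith
  have hmain : B ^ 2 ≤ 4 * (B * (A * (((1 / 2 - θ)⁻¹ + 1) * (n : ℝ) ^ (1 / 2 - θ))) *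
      (A * ((1 / 2 - θ)⁻¹ * (n : ℝ) ^ (1 / 2 - θ)) / (n : ℝ) ^ 2)) := by
    rw [← ENNReal.ofReal_le_ofReal_iff (by positivity), ENNReal.ofReal_pow hB0,
      ENNReal.ofReal_mul (by norm_num)]
    refine (pow_le_pow_left' (hlower.trans hupper) 2).trans ?_
    rw [mul_pow]
    refine mul_le_mul' ?_ hsq
    rw [show (4 : ℝ) = 2 ^ 2 by norm_num, ENNReal.ofReal_pow (by norm_num)]
    simp
  have hpow : (n : ℝ) ^ (1 / 2 - θ) * (n : ℝ) ^ (1 / 2 - θ) / (n : ℝ) ^ 2 =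
      ((n : ℝ) ^ (1 + 2 * θ))⁻¹ := by
    rw [← Real.rpow_add hn0, ← Real.rpow_two, ← Real.rpow_sub hn0, ← Real.rpow_neg hn0.le]
    congr 1
    ring
  -- The crude bound `1 ≤ 1 / (1 - 2 * θ)` suffices for the added `1`.
  have hconst : ((1 / 2 - θ)⁻¹ + 1) * (1 / 2 - θ)⁻¹ ≤ 6 / (1 - 2 * θ) ^ 2 := by
    have h2 : 0 < 1 - 2 * θ := by linarith
    have h3 : (1 / 2 - θ)⁻¹ = 2 / (1 - 2 * θ) := by
      rw [eq_div_iff h2.ne', inv_mul_eq_iff_eq_mul₀ hr.ne']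
      ring
    rw [h3, div_add_one h2.ne', div_mul_div_comm, ← sq]
    gcongr
    linarith
  have hle : B ^ 2 ≤ B * (24 * A ^ 2 / ((1 - 2 * θ) ^ 2 * (n : ℝ) ^ (1 + 2 * θ))) := by
    refine hmain.trans ?_
    calc _ = B * (4 * A ^ 2) * (((1 / 2 - θ)⁻¹ + 1) * (1 / 2 - θ)⁻¹) *
          ((n : ℝ) ^ (1 / 2 - θ) * (n : ℝ) ^ (1 / 2 - θ) / (n : ℝ) ^ 2) := by ring
      _ ≤ B * (4 * A ^ 2) * (6 / (1 - 2 * θ) ^ 2) * ((n : ℝ) ^ (1 + 2 * θ))⁻¹ := by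
          rw [hpow]
          gcongr
      _ = _ := by
          rw [div_eq_mul_inv, div_eq_mul_inv, mul_inv]
          ring
  rcases hB0.eq_or_lt with h0 | hpos
  · rw [← h0]
    positivity
  · rw [sq] at hle
    exact le_of_mul_le_mul_left hle hpos

end WeightedGraph

theorem theorem3p1 {V E : Type*} [Countable V] [Countable E] (G : WeightedGraph V E)
    (hconn : G.IsConnected) (o : V)
    (Γ : Subgroup G.Aut) (hclosed : WeightedGraph.IsClosedSubgroup Γ)
    (htrans : WeightedGraph.IsTransitive Γ) (hunim : WeightedGraph.IsUnimodular Γ)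
    (μ : MeasureTheory.Measure (E → unitInterval)) [MeasureTheory.IsProbabilityMeasure μ]
    (hinv : WeightedGraph.IsInvariantEnv Γ μ)
    (A θ : ℝ) (hθ0 : 0 ≤ θ) (hθ : θ < 1 / 2)
    (htail : ∀ n : ℕ, 1 ≤ n →
      (WeightedGraph.percLaw μ).real {x | (n : ℕ∞) ≤ (G.cluster x.2 o).encard}
        ≤ A * (n : ℝ) ^ (-θ))
    (n : ℕ) (hn : 1 ≤ n) :
    ∑' e : G.edgesAt o, G.twoArmExpectation μ e n ^ 2
      ≤ ENNReal.ofReal (10000 * A ^ 2 / ((1 - 2 * θ) ^ 2 * (n : ℝ) ^ (1 + 2 * θ))) := by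
  classical
  have hA : 0 ≤ A := by
    have h := measureReal_nonneg.trans (htail 1 le_rfl)
    simpa using h
  have htail' : ∀ j : ℕ, 1 ≤ j →
      WeightedGraph.percLaw μ {x | (j : ℕ∞) ≤ (G.cluster x.2 o).encard} ≤
        ENNReal.ofReal (A * (j : ℝ) ^ (-θ)) := fun j hj =>
    (ENNReal.le_ofReal_iff_toReal_le (measure_ne_top _ _) (by positivity)).2 (htail j hj)
  have hle1 : ∀ e, G.twoArmExpectation μ e n ≤ 1 := fun e =>
    WeightedGraph.twoArmExpectation_le_one μ e n
  have hne : ∀ e, G.twoArmExpectation μ e n ≠ ⊤ := fun e =>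
    ne_top_of_le_ne_top ENNReal.one_ne_top (hle1 e)
  rw [ENNReal.tsum_eq_iSup_sum]
  refine iSup_le fun s => ?_
  -- Truncating by the weights makes the edge function finitely supported at each vertex and keeps
  -- it invariant, since automorphisms preserve the weights.
  set F : E → ℝ := fun e => if ∃ a ∈ s, G.J a.1 ≤ G.J e then
    (G.twoArmExpectation μ e n).toReal else 0 with hFdef
  have hF : ∀ e, 0 ≤ F e := by
    intro e
    simp only [hFdef]
    split_ifs
    exacts [ENNReal.toReal_nonneg, le_rfl]
  have hFinv : ∀ γ ∈ Γ, ∀ e, F (WeightedGraph.Aut.edge γ e) = F e := by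
    intro γ hγ e
    simp only [hFdef, WeightedGraph.Aut.J_edge,
      WeightedGraph.twoArmExpectation_edge hinv hγ]
  have hFle : ∀ e, ENNReal.ofReal (F e) ≤ G.twoArmExpectation μ e n := by
    intro e
    simp only [hFdef]
    split_ifs
    · rw [ENNReal.ofReal_toReal (hne e)]
    · simp
  have hfin : ∀ v, {e | v ∈ G.ends e ∧ F e ≠ 0}.Finite := by
    intro v
    refine (s.finite_toSet.biUnion fun a _ =>
      WeightedGraph.finite_edgesAt_le_J G v (G.J_pos a.1)).subset ?_
    rintro e ⟨hv, he⟩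
    simp only [hFdef, ne_eq, ite_eq_right_iff, not_forall] at he
    obtain ⟨⟨a, ha, hJ⟩, -⟩ := he
    exact Set.mem_biUnion ha ⟨hv, hJ⟩
  have key := WeightedGraph.sum_sq_le htrans hunim hinv hA hθ0 hθ htail' hn hF hFinv hFle
    (D := fun v => (hfin v).toFinset) (fun v e => by simp)
  calc ∑ a ∈ s, G.twoArmExpectation μ a n ^ 2
      = ∑ e ∈ s.map (Function.Embedding.subtype _), ENNReal.ofReal (F e ^ 2) := by
        rw [Finset.sum_map]
        refine Finset.sum_congr rfl fun a ha => ?_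
        have hFa : F a = (G.twoArmExpectation μ a n).toReal := if_pos ⟨a, ha, le_rfl⟩
        rw [Function.Embedding.subtype_apply, hFa, ENNReal.ofReal_pow ENNReal.toReal_nonneg,
          ENNReal.ofReal_toReal (hne a)]
    _ ≤ ∑ e ∈ (hfin o).toFinset, ENNReal.ofReal (F e ^ 2) := by
        refine Finset.sum_le_sum_of_ne_zero fun e he h0 => ?_
        obtain ⟨a, -, rfl⟩ := Finset.mem_map.1 he
        refine (hfin o).mem_toFinset.2 ⟨a.2, fun h => h0 ?_⟩
        rw [h, zero_pow two_ne_zero, ENNReal.ofReal_zero]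
    _ = ENNReal.ofReal (∑ e ∈ (hfin o).toFinset, F e ^ 2) :=
        (ENNReal.ofReal_sum_of_nonneg fun _ _ => sq_nonneg _).symm
    _ ≤ ENNReal.ofReal (10000 * A ^ 2 / ((1 - 2 * θ) ^ 2 * (n : ℝ) ^ (1 + 2 * θ))) := by
        refine ENNReal.ofReal_le_ofReal (key.trans ?_)
        gcongr
        norm_num
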